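/- Let $q\in\mathbb{C}^\times$ be not a root of unity. All superspaces and superalgebras are over $\mathbb{C}$. Let $\mathbb{V}=\mathbb{C}v_1\oplus\mathbb{C}v_2$ with $v_1$ even and $v_2$ odd; put $|1|=0$, $|2|=1\in\mathbb{Z}/2$, $q_1=q$, $q_2=q^{-1}$, and let $E_{ij}\in\mathrm{End}\,\mathbb{V}$ be the matrix units. Let $$R(z,w)=\sum_{i}(zq_i-wq_i^{-1})E_{ii}\otimes E_{ii}+(z-w)\sum_{i\ne j}E_{ii}\otimes E_{jj}+z\sum_{i<j}(q_i-q_i^{-1})E_{ji}\otimes E_{ij}+w\sum_{i<j}(q_j-q_j^{-1})E_{ij}\otimes E_{ji}.$$ The quantum affine superalgebra $U_q(\widehat{\mathfrak{gl}(1,1)})$ is the superalgebra with generators $s_{ij}^{(n)},t_{ij}^{(n)}$ ($i,j\in\{1,2\}$, $n\ge 0$) of parity $|i|+|j|$ and relations $$R_{23}(z,w)T_{12}(z)T_{13}(w)=T_{13}(w)T_{12}(z)R_{23}(z,w),\quad R_{23}(z,w)S_{12}(z)S_{13}(w)=S_{13}(w)S_{12}(z)R_{23}(z,w),$$ $$R_{23}(z,w)T_{12}(z)S_{13}(w)=S_{13}(w)T_{12}(z)R_{23}(z,w),\quad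 t_{12}^{(0)}=s_{21}^{(0)}=0,\quad t_{ii}^{(0)}s_{ii}^{(0)}=1=s_{ii}^{(0)}t_{ii}^{(0)},$$ where $S(z)=\sum_{i,j}s_{ij}(z)\otimes E_{ij}$, $s_{ij}(z)=\sum_{n\ge0}s_{ij}^{(n)}z^n$, $T(z)=\sum_{i,j}t_{ij}(z)\otimes E_{ij}$, $t_{ij}(z)=\sum_{n\ge0}t_{ij}^{(n)}z^{-n}$, and tensor products are those of superalgebras. The $q$-Yangian $Y_q(\mathfrak{gl}(1,1))$ is its subalgebra generated by all $s_{ij}^{(n)}$ and the $(s_{ii}^{(0)})^{-1}$. Modules over $Y_q(\mathfrak{gl}(1,1))$ are $\mathbb{Z}/2$-graded; such a module is simple if it is non-zero and has no $\mathbb{Z}/2$-graded submodules other than $0$ and itself. A highest $\ell$-weight vector is a non-zero $\mathbb{Z}/2$-homogeneous vector $v$ with $s_{12}^{(n)}v=0$ and $s_{11}^{(n)}v,\,s_{22}^{(n)}v\in\mathbb{C}v$ for all $n\ge0$; a module is of highest $\ell$-weight if it is generated by a highest $\ell$-weight vector. **Lemma.** (1) Every finite-dimensional simple $Y_q(\mathfrak{gl}(1,1))$-module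 is of highest $\ell$-weight. (2) Let $S$ be a simple $Y_q(\mathfrak{gl}(1,1))$-module generated by an even highest $\ell$-weight vector $v$ with $s_{ii}(z)v=f_i(z)v$, $f_i(z)\in(\mathbb{C}[[z]])^\times$, for $i=1,2$. Then $S$ is finite-dimensional if and only if $\dfrac{f_1(z)}{f_2(z)}=\dfrac{P(z)}{Q(z)}$ in $\mathbb{C}[[z]]$ for some polynomials $P(z),Q(z)\in\mathbb{C}[z]$ with non-zero constant terms. -/

import Mathlib

open scoped DirectSum PowerSeries

noncomputable section

namespace QYangian

/-! ### Signs and the Perk-Schultz matrix of `gl(1,1)`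

The index set `I = {1, 2}` is modelled by `Fin 2`, with `0` standing for the even index `1` and
`1` standing for the odd index `2`. -/

/-- The parity `|i|` of an index. -/
def par (i : Fin 2) : ZMod 2 := ![0, 1] i

/-- The sign map `(-1)^x` on `ℤ/2`. -/
def sgn (x : ZMod 2) : ℂ := if x = 0 then 1 else -1

/-- `q_1 = q` and `q_2 = q⁻¹`. -/
def qi (q : ℂ) (i : Fin 2) : ℂ := ![q, q⁻¹] i

/-- The element `E_ij ⊗ E_kl` of the superalgebra `End V ⊗ End V`, where `V = ℂ v_1 ⊕ ℂ v_2` with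
`v_1` even and `v_2` odd, identified (through `End V ⊗ End V ≅ End (V ⊗ V)`) with the matrix of the
operator `v_j ⊗ v_l ↦ (-1)^{|E_kl| |v_j|} v_i ⊗ v_k`. Under this identification the product of the
superalgebra `End V ⊗ End V` is the matrix product. -/
def superE (i j k l : Fin 2) : Matrix (Fin 2 × Fin 2) (Fin 2 × Fin 2) ℂ :=
  Matrix.single (i, k) (j, l) (sgn ((par k + par l) * par j))

/-- The coefficient of `z` in the Perk-Schultz matrix `R(z,w)`. -/
def Rz (q : ℂ) : Matrix (Fin 2 × Fin 2) (Fin 2 × Fin 2) ℂ :=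
  (∑ i, qi q i • superE i i i i)
    + (∑ i, ∑ j, if i ≠ j then superE i i j j else 0)
    + (∑ i, ∑ j, if i < j then (qi q i - (qi q i)⁻¹) • superE j i i j else 0)

/-- The coefficient of `w` in the Perk-Schultz matrix `R(z,w)`; thus
`R(z,w) = z • Rz + w • Rw`. -/
def Rw (q : ℂ) : Matrix (Fin 2 × Fin 2) (Fin 2 × Fin 2) ℂ :=
  -(∑ i, (qi q i)⁻¹ • superE i i i i)
    - (∑ i, ∑ j, if i ≠ j then superE i i j j else 0)
    + (∑ i, ∑ j, if i < j then (qi q j - (qi q j)⁻¹) • superE i j j i else 0)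

/-! ### The quantum affine superalgebra -/

/-- The generators `s_ij^(n)` and `t_ij^(n)`. -/
inductive Gen : Type
  | s (i j : Fin 2) (n : ℕ) : Gen
  | t (i j : Fin 2) (n : ℕ) : Gen

/-- `|s_ij^(n)| = |t_ij^(n)| = |i| + |j|`. -/
def Gen.parity : Gen → ZMod 2
  | .s i j _ => par i + par j
  | .t i j _ => par i + par j

/-- The free algebra on the generators. -/
abbrev Free : Type := FreeAlgebra ℂ Gen

/-- The coefficient of `z^k` (`k ∈ ℤ`) in `s_ij(z) = ∑_{n ≥ 0} s_ij^(n) z^n`. -/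
def coeffS (i j : Fin 2) (k : ℤ) : Free :=
  if 0 ≤ k then FreeAlgebra.ι ℂ (Gen.s i j k.toNat) else 0

/-- The coefficient of `z^k` (`k ∈ ℤ`) in `t_ij(z) = ∑_{n ≥ 0} t_ij^(n) z^{-n}`. -/
def coeffT (i j : Fin 2) (k : ℤ) : Free :=
  if k ≤ 0 then FreeAlgebra.ι ℂ (Gen.t i j (-k).toNat) else 0

/-- The scalar matrix `M ∈ End V ⊗ End V` viewed as `1 ⊗ M`. -/
def scal (M : Matrix (Fin 2 × Fin 2) (Fin 2 × Fin 2) ℂ) :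
    Matrix (Fin 2 × Fin 2) (Fin 2 × Fin 2) Free :=
  M.map (algebraMap ℂ Free)

/-- The element `a ⊗ M` of the super tensor product of the free algebra with
`End V ⊗ End V`, as a matrix with entries in the free algebra. -/
def tens (a : Free) (M : Matrix (Fin 2 × Fin 2) (Fin 2 × Fin 2) ℂ) :
    Matrix (Fin 2 × Fin 2) (Fin 2 × Fin 2) Free :=
  M.map (fun c => c • a)

/-- The coefficient of `z^m w^n` in `X_12(z) Y_13(w)`, where `X(z) = ∑ X_ij(z) ⊗ E_ij`,
`Y(w) = ∑ Y_kl(w) ⊗ E_kl`, the entries having parity `|i| + |j|` and `|k| + |l|`. In the super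
tensor product,
`(X_ij ⊗ E_ij ⊗ 1) (Y_kl ⊗ 1 ⊗ E_kl) = (-1)^{|E_ij| |Y_kl|} X_ij Y_kl ⊗ E_ij ⊗ E_kl`. -/
def prod1213 (X Y : Fin 2 → Fin 2 → ℤ → Free) (m n : ℤ) :
    Matrix (Fin 2 × Fin 2) (Fin 2 × Fin 2) Free :=
  ∑ i, ∑ j, ∑ k, ∑ l,
    tens (sgn ((par i + par j) * (par k + par l)) • (X i j m * Y k l n)) (superE i j k l)

/-- The coefficient of `z^m w^n` in `Y_13(w) X_12(z)`. In the super tensor product,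
`(Y_kl ⊗ 1 ⊗ E_kl) (X_ij ⊗ E_ij ⊗ 1) = Y_kl X_ij ⊗ E_ij ⊗ E_kl`: the sign created by moving
`E_kl` past `X_ij` cancels the one created by moving `E_kl` past `E_ij`. -/
def prod1312 (Y X : Fin 2 → Fin 2 → ℤ → Free) (m n : ℤ) :
    Matrix (Fin 2 × Fin 2) (Fin 2 × Fin 2) Free :=
  ∑ i, ∑ j, ∑ k, ∑ l, tens (Y k l n * X i j m) (superE i j k l)

/-- The coefficient of `z^m w^n` in `R_23(z,w) X_12(z) Y_13(w)`. -/
def rttLeft (q : ℂ) (X Y : Fin 2 → Fin 2 → ℤ → Free) (m n : ℤ) :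
    Matrix (Fin 2 × Fin 2) (Fin 2 × Fin 2) Free :=
  scal (Rz q) * prod1213 X Y (m - 1) n + scal (Rw q) * prod1213 X Y m (n - 1)

/-- The coefficient of `z^m w^n` in `Y_13(w) X_12(z) R_23(z,w)`. -/
def rttRight (q : ℂ) (X Y : Fin 2 → Fin 2 → ℤ → Free) (m n : ℤ) :
    Matrix (Fin 2 × Fin 2) (Fin 2 × Fin 2) Free :=
  prod1312 Y X (m - 1) n * scal (Rz q) + prod1312 Y X m (n - 1) * scal (Rw q)

/-- The defining relations of the quantum affine superalgebra of `gl(1,1)`. -/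
inductive Rel (q : ℂ) : Free → Free → Prop
  /-- `R_23(z,w) T_12(z) T_13(w) = T_13(w) T_12(z) R_23(z,w)` -/
  | rtt (m n : ℤ) (a b : Fin 2 × Fin 2) :
      Rel q (rttLeft q coeffT coeffT m n a b) (rttRight q coeffT coeffT m n a b)
  /-- `R_23(z,w) S_12(z) S_13(w) = S_13(w) S_12(z) R_23(z,w)` -/
  | rss (m n : ℤ) (a b : Fin 2 × Fin 2) :
      Rel q (rttLeft q coeffS coeffS m n a b) (rttRight q coeffS coeffS m n a b)
  /-- `R_23(z,w) T_12(z) S_13(w) = S_13(w) T_12(z) R_23(z,w)` -/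
  | rts (m n : ℤ) (a b : Fin 2 × Fin 2) :
      Rel q (rttLeft q coeffT coeffS m n a b) (rttRight q coeffT coeffS m n a b)
  | t_zero (i j : Fin 2) (h : i < j) : Rel q (FreeAlgebra.ι ℂ (Gen.t i j 0)) 0
  | s_zero (i j : Fin 2) (h : i < j) : Rel q (FreeAlgebra.ι ℂ (Gen.s j i 0)) 0
  | ts_one (i : Fin 2) :
      Rel q (FreeAlgebra.ι ℂ (Gen.t i i 0) * FreeAlgebra.ι ℂ (Gen.s i i 0)) 1
  | st_one (i : Fin 2) :
      Rel q (FreeAlgebra.ι ℂ (Gen.s i i 0) * FreeAlgebra.ι ℂ (Gen.t i i 0)) 1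

/-- The quantum affine superalgebra `U_q` of `gl(1,1)`, as an associative `ℂ`-algebra. -/
def Uq (q : ℂ) : Type := RingQuot (Rel q)

instance (q : ℂ) : Ring (Uq q) := inferInstanceAs (Ring (RingQuot (Rel q)))

instance (q : ℂ) : Algebra ℂ (Uq q) := inferInstanceAs (Algebra ℂ (RingQuot (Rel q)))

/-- The quotient map from the free algebra. -/
def mk (q : ℂ) : Free →ₐ[ℂ] Uq q := RingQuot.mkAlgHom ℂ (Rel q)

/-- A generator, as an element of `U_q`. -/
def gen (q : ℂ) (g : Gen) : Uq q := mk q (FreeAlgebra.ι ℂ g)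

/-- The homogeneous components of the `ℤ/2`-grading of `U_q`: the component of parity `k` is
spanned by the words in the generators of total parity `k`. -/
def Uq.component (q : ℂ) (k : ZMod 2) : Submodule ℂ (Uq q) :=
  Submodule.span ℂ {x | ∃ l : List Gen, (l.map Gen.parity).sum = k ∧ (l.map (gen q)).prod = x}

/-! ### The `q`-Yangian -/

/-- In `U_q` the element `t_ii^(0)` is the inverse of `s_ii^(0)`. -/
theorem gen_t_mul_gen_s (q : ℂ) (i : Fin 2) : gen q (.t i i 0) * gen q (.s i i 0) = 1 := by
  have h := RingQuot.mkAlgHom_rel ℂ (Rel.ts_one (q := q) i)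
  rw [map_mul, map_one] at h
  exact h

/-- In `U_q` the element `t_ii^(0)` is the inverse of `s_ii^(0)`. -/
theorem gen_s_mul_gen_t (q : ℂ) (i : Fin 2) : gen q (.s i i 0) * gen q (.t i i 0) = 1 := by
  have h := RingQuot.mkAlgHom_rel ℂ (Rel.st_one (q := q) i)
  rw [map_mul, map_one] at h
  exact h

/-- The element `s_ii^(0)` as a unit of `U_q`. -/
def sUnit (q : ℂ) (i : Fin 2) : (Uq q)ˣ where
  val := gen q (.s i i 0)
  inv := gen q (.t i i 0)
  val_inv := gen_s_mul_gen_t q i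
  inv_val := gen_t_mul_gen_s q i

/-- The `q`-Yangian `Y_q(gl(1,1))`: the subalgebra of `U_q` generated by all `s_ij^(n)` and the
inverses of the `s_ii^(0)`. -/
def Yq (q : ℂ) : Subalgebra ℂ (Uq q) :=
  Algebra.adjoin ℂ
    ({x | ∃ i j n, gen q (.s i j n) = x} ∪ {x | ∃ i, (((sUnit q i)⁻¹ : (Uq q)ˣ) : Uq q) = x})

/-- The element `s_ij^(n)` of the `q`-Yangian. -/
def Yq.s (q : ℂ) (i j : Fin 2) (n : ℕ) : Yq q :=
  ⟨gen q (.s i j n), Algebra.subset_adjoin (Or.inl ⟨i, j, n, rfl⟩)⟩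

/-- The `ℤ/2`-grading of the `q`-Yangian, induced by that of `U_q`. -/
def Yq.component (q : ℂ) (k : ZMod 2) : Submodule ℂ (Yq q) :=
  (Uq.component q k).comap (Yq q).val.toLinearMap

/-! ### Modules over the superalgebra `Y_q(gl(1,1))`

A module over the superalgebra `Y_q` is a `ℂ`-vector space `V` with an action of the algebra `Y_q`
and a decomposition `V = 𝒱 0 ⊕ 𝒱 1` for which the action is graded. -/

section Modules

variable {V : Type*} [AddCommGroup V] [Module ℂ V]

/-- Simplicity in the category of modules over a superalgebra: the module is nonzero and its only
`ℤ/2`-graded submodules are `0` and itself. -/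
def IsSimpleSuper (q : ℂ) [Module (Yq q) V] (𝒱 : ZMod 2 → Submodule ℂ V)
    [DirectSum.Decomposition 𝒱] : Prop :=
  Nontrivial V ∧ ∀ W : Submodule (Yq q) V, W.IsHomogeneous 𝒱 → W = ⊥ ∨ W = ⊤

/-- Highest `ℓ`-weight vectors. -/
structure IsHighestLWeightVector (q : ℂ) [Module (Yq q) V] (𝒱 : ZMod 2 → Submodule ℂ V)
    (v : V) : Prop where
  ne_zero : v ≠ 0
  homogeneous : ∃ k, v ∈ 𝒱 k
  annihilated : ∀ (i j : Fin 2) (n : ℕ), i < j → Yq.s q i j n • v = 0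
  eigenvector : ∀ (k : Fin 2) (n : ℕ), ∃ c : ℂ, Yq.s q k k n • v = c • v

/-- Highest `ℓ`-weight modules: those generated by a highest `ℓ`-weight vector. -/
def IsHighestLWeightModule (q : ℂ) [Module (Yq q) V] (𝒱 : ZMod 2 → Submodule ℂ V) : Prop :=
  ∃ v : V, IsHighestLWeightVector q 𝒱 v ∧ Submodule.span (Yq q) {v} = ⊤

end Modules

end QYangian

end

noncomputable section

namespace QYangian

/-! Write `A`, `B`, `C`, `D` for the coefficients of `s_11`, `s_12`, `s_21`, `s_22`; each relation
used is one entry of the RTT identity (`rttOperators_sOp`).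

Part (1): `A_0 B_n = q B_n A_0` and `A_0` is invertible, so in finite dimension, `q` not being a
root of unity, some nonzero vector is killed by all `B_n`. The space of such vectors is graded and
stable under `A` and `D`, which commute on it; a common eigenvector in one parity is a highest
weight vector, and simplicity makes it generate.

Part (2): straightening shows that words in the `C_n` applied to `v` span the simple module
(`IsSingularSubspace.iSup_words_eq_top`). The bridge to power series is `RTTOperators.B_C_apply`: up
to the factor `q - q⁻¹`, `B_m C_n v` is `v` times the coefficient of `z^(m+n)` in `W_n = f g_{<n} -
g f_{<n}`. A linear relation among the `C_i v` therefore yields `f R = g R'` with `R`, `R'`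
polynomials, which gives necessity.

Conversely, if `u f` and `u g` are polynomials, the coefficients of `u` give combinations of the
`C_i v` killed by every `B_m`. These vanish by simplicity, so finitely many `C_i v` span all of
them. The `CC` relation then behaves like that of a `q`-exterior algebra: long words vanish and the
module is finite-dimensional. -/

/-- Coefficients of negative index are zero, so recursions lowering an index need no separate base
case. A relation taken at `(m, n + 1)` links the index pairs `(m, n)` and `(m - 1, n + 1)`, which is
why the other index is generalized in these inductions. -/
theorem int_induction_of_neg {P : ℤ → Prop} (neg : ∀ m < 0, P m) (step : ∀ m, P (m - 1) → P m)
    (m : ℤ) : P m := by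
  rcases lt_or_ge m 0 with h | h
  · exact neg m h
  · induction m, h using Int.leInduction with
    | base => exact step 0 (neg _ (by norm_num))
    | succ k _ ih => exact step (k + 1) (by simpa using ih)

/-! ### The `RTT` relations as relations between operators -/

section Operators

variable {V : Type*} [AddCommGroup V] [Module ℂ V]

/-- Operators `A_n`, `B_n`, `C_n`, `D_n` satisfying the relations of the coefficients of
`s_11(z)`, `s_12(z)`, `s_21(z)`, `s_22(z)` that are used below. -/
structure RTTOperators (q : ℂ) (A B C D : ℤ → Module.End ℂ V) : Prop where
  A_neg : ∀ n < 0, A n = 0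
  B_neg : ∀ n < 0, B n = 0
  C_neg : ∀ n < 0, C n = 0
  D_neg : ∀ n < 0, D n = 0
  C_zero : C 0 = 0
  AA : ∀ m n x, q • A (m - 1) (A n x) - q⁻¹ • A m (A (n - 1) x) =
    q • A n (A (m - 1) x) - q⁻¹ • A (n - 1) (A m x)
  DD : ∀ m n x, q⁻¹ • D (m - 1) (D n x) - q • D m (D (n - 1) x) =
    q⁻¹ • D n (D (m - 1) x) - q • D (n - 1) (D m x)
  AD : ∀ m n x, A (m - 1) (D n x) - A m (D (n - 1) x) - (q - q⁻¹) • C m (B (n - 1) x) =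
    D n (A (m - 1) x) - (q - q⁻¹) • C n (B (m - 1) x) - D (n - 1) (A m x)
  AB : ∀ m n x, q • A (m - 1) (B n x) - q⁻¹ • A m (B (n - 1) x) =
    B n (A (m - 1) x) + (q - q⁻¹) • A n (B (m - 1) x) - B (n - 1) (A m x)
  BD : ∀ m n x, B (m - 1) (D n x) - B m (D (n - 1) x) - (q - q⁻¹) • D m (B (n - 1) x) =
    q⁻¹ • D n (B (m - 1) x) - q • D (n - 1) (B m x)
  AC : ∀ m n x, A (m - 1) (C n x) - A m (C (n - 1) x) + (q - q⁻¹) • C m (A (n - 1) x) =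
    q • C n (A (m - 1) x) - q⁻¹ • C (n - 1) (A m x)
  CD : ∀ m n x, q⁻¹ • C (m - 1) (D n x) - q • C m (D (n - 1) x) =
    D n (C (m - 1) x) - (q - q⁻¹) • C n (D (m - 1) x) - D (n - 1) (C m x)
  BC : ∀ m n x, B (m - 1) (C n x) - B m (C (n - 1) x) + (q - q⁻¹) • D m (A (n - 1) x) =
    - C n (B (m - 1) x) + (q - q⁻¹) • D (n - 1) (A m x) + C (n - 1) (B m x)
  CC : ∀ m n x, - (q⁻¹ • C (m - 1) (C n x)) + q • C m (C (n - 1) x) =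
    q • C n (C (m - 1) x) - q⁻¹ • C (n - 1) (C m x)

namespace RTTOperators

variable {q : ℂ} {A B C D : ℤ → Module.End ℂ V} (h : RTTOperators q A B C D)
include h

theorem A_zero_B (n : ℤ) (x : V) (hq : q ≠ 0) : A 0 (B n x) = q • B n (A 0 x) := by
  have := h.AB 0 (n + 1) x
  simp only [zero_sub, add_sub_cancel_right, h.A_neg (-1) (by norm_num),
    h.B_neg (-1) (by norm_num), LinearMap.zero_apply, map_zero, smul_zero, zero_add,
    neg_inj] at this
  rw [← this, smul_smul, mul_inv_cancel₀ hq, one_smul]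

theorem A_zero_C (n : ℤ) (x : V) : A 0 (C n x) = q⁻¹ • C n (A 0 x) := by
  have := h.AC 0 (n + 1) x
  simpa only [zero_sub, add_sub_cancel_right, h.A_neg (-1) (by norm_num), h.C_zero,
    LinearMap.zero_apply, map_zero, smul_zero, add_zero, neg_inj] using this

theorem D_zero_C (n : ℤ) (x : V) : D 0 (C n x) = q⁻¹ • C n (D 0 x) := by
  have := h.CD (n + 1) 0 x
  simpa only [zero_sub, add_sub_cancel_right, h.D_neg (-1) (by norm_num), h.C_zero,
    LinearMap.zero_apply, map_zero, smul_zero, sub_zero, eq_comm] using this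

theorem A_comm (hq : q ≠ 0) (m n : ℤ) (x : V) : A m (A n x) = A n (A m x) := by
  induction m using int_induction_of_neg generalizing n with
  | neg m hm => simp [h.A_neg m hm]
  | step m ih =>
    have h1 := h.AA m (n + 1) x
    rw [add_sub_cancel_right, ih (n + 1), sub_right_inj] at h1
    exact smul_right_injective V (inv_ne_zero hq) h1

theorem D_comm (hq : q ≠ 0) (m n : ℤ) (x : V) : D m (D n x) = D n (D m x) := by
  induction m using int_induction_of_neg generalizing n with
  | neg m hm => simp [h.D_neg m hm]
  | step m ih =>
    have h1 := h.DD m (n + 1) x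
    rw [add_sub_cancel_right, ih (n + 1), sub_right_inj] at h1
    exact smul_right_injective V hq h1

theorem A_D_comm {x : V} (hx : ∀ n, B n x = 0) (m n : ℤ) : A m (D n x) = D n (A m x) := by
  induction m using int_induction_of_neg generalizing n with
  | neg m hm => simp [h.A_neg m hm]
  | step m ih =>
    have h1 := h.AD m (n + 1) x
    simpa [ih (n + 1), hx] using h1

theorem B_A_eq_zero {x : V} (hx : ∀ n, B n x = 0) (m n : ℤ) : B n (A m x) = 0 := by
  induction m using int_induction_of_neg generalizing n with
  | neg m hm => simp [h.A_neg m hm]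
  | step m ih =>
    have h1 := h.AB m (n + 1) x
    simpa [ih (n + 1), hx] using h1

theorem B_D_eq_zero {x : V} (hx : ∀ n, B n x = 0) (m n : ℤ) : B n (D m x) = 0 := by
  induction n using int_induction_of_neg generalizing m with
  | neg n hn => simp [h.B_neg n hn]
  | step n ih =>
    have h1 := h.BD n (m + 1) x
    simpa [ih (m + 1), hx] using h1

end RTTOperators

/-- The span of the vectors `C_{n_1} ⋯ C_{n_k} x` with `x ∈ K`. -/
def words (C : ℤ → Module.End ℂ V) (K : Submodule ℂ V) : ℕ → Submodule ℂ V
  | 0 => K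
  | k + 1 => ⨆ n, (words C K k).map (C n)

/-! ### Straightening: the action of the four series on words in the `C_n`. -/

section words

variable {C : ℤ → Module.End ℂ V} {K : Submodule ℂ V}

theorem C_mem_words {k : ℕ} {x : V} (hx : x ∈ words C K k) (n : ℤ) : C n x ∈ words C K (k + 1) :=
  Submodule.mem_iSup_of_mem n (Submodule.mem_map_of_mem hx)

theorem words_succ_le {k : ℕ} {W : Submodule ℂ V}
    (hW : ∀ n, ∀ x ∈ words C K k, C n x ∈ W) : words C K (k + 1) ≤ W :=
  iSup_le fun n => Submodule.map_le_iff_le_comap.2 fun x hx => hW n x hx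

variable {q : ℂ} {A B D : ℤ → Module.End ℂ V} (h : RTTOperators q A B C D)
include h

/-- The `AC` relation trades `A_m C_n` for `A_{m-1} C_{n+1}` plus terms in which `A` acts on a
shorter word. The outer induction is on length, the inner one on `m`. -/
theorem RTTOperators.A_mem_words (hK : ∀ n, ∀ x ∈ K, A n x ∈ K) (k : ℕ) (m : ℤ) {x : V}
    (hx : x ∈ words C K k) : A m x ∈ words C K k := by
  induction k generalizing m x with
  | zero => exact hK m x hx
  | succ k ih =>
    refine words_succ_le (W := (words C K (k + 1)).comap (A m)) (fun n y hy => ?_) hx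
    rw [Submodule.mem_comap]
    clear hx
    induction m using int_induction_of_neg generalizing n with
    | neg m hm => simp [h.A_neg m hm]
    | step m ihm =>
      have h1 := h.AC m (n + 1) y
      have h2 : A m (C n y) = A (m - 1) (C (n + 1) y) + (q - q⁻¹) • C m (A n y)
          - q • C (n + 1) (A (m - 1) y) + q⁻¹ • C n (A m y) := by
        rw [add_sub_cancel_right] at h1
        linear_combination (norm := module) -h1
      rw [h2]
      exact add_mem (sub_mem (add_mem (ihm _) (Submodule.smul_mem _ _ (C_mem_words (ih _ hy) _)))
        (Submodule.smul_mem _ _ (C_mem_words (ih _ hy) _)))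
        (Submodule.smul_mem _ _ (C_mem_words (ih _ hy) _))

theorem RTTOperators.D_mem_words (hK : ∀ n, ∀ x ∈ K, D n x ∈ K) (k : ℕ) (m : ℤ) {x : V}
    (hx : x ∈ words C K k) : D m x ∈ words C K k := by
  induction k generalizing m x with
  | zero => exact hK m x hx
  | succ k ih =>
    refine words_succ_le (W := (words C K (k + 1)).comap (D m)) (fun n y hy => ?_) hx
    rw [Submodule.mem_comap]
    clear hx
    induction m using int_induction_of_neg generalizing n with
    | neg m hm => simp [h.D_neg m hm]
    | step m ihm =>
      have h1 := h.CD (n + 1) m y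
      have h2 : D m (C n y) = D (m - 1) (C (n + 1) y) + (q - q⁻¹) • C m (D n y)
          - q • C (n + 1) (D (m - 1) y) + q⁻¹ • C n (D m y) := by
        rw [add_sub_cancel_right] at h1
        linear_combination (norm := module) -h1
      rw [h2]
      exact add_mem (sub_mem (add_mem (ihm _) (Submodule.smul_mem _ _ (C_mem_words (ih _ hy) _)))
        (Submodule.smul_mem _ _ (C_mem_words (ih _ hy) _)))
        (Submodule.smul_mem _ _ (C_mem_words (ih _ hy) _))

/-- Moving `B` past one `C` by the `BC` relation produces terms `D A`, which lose that letter and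
keep the rest, and terms `C B`, handled by the induction on length. For words of length one the
latter vanish because `B` kills `K`. -/
theorem RTTOperators.B_mem_words (hA : ∀ n, ∀ x ∈ K, A n x ∈ K) (hD : ∀ n, ∀ x ∈ K, D n x ∈ K)
    (hB : ∀ n, ∀ x ∈ K, B n x = 0) (k : ℕ) (m : ℤ) {x : V}
    (hx : x ∈ words C K (k + 1)) : B m x ∈ words C K k := by
  induction k generalizing m x with
  | zero =>
    refine words_succ_le (W := (words C K 0).comap (B m)) (fun n y hy => ?_) hx
    rw [Submodule.mem_comap]
    clear hx
    induction m using int_induction_of_neg generalizing n with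
    | neg m hm => simp [h.B_neg m hm]
    | step m ihm =>
      have h1 := h.BC m (n + 1) y
      have h2 : B m (C n y) = B (m - 1) (C (n + 1) y) + (q - q⁻¹) • D m (A n y)
          - (q - q⁻¹) • D n (A m y) := by
        rw [add_sub_cancel_right, hB _ _ hy, hB _ _ hy, map_zero, map_zero] at h1
        linear_combination (norm := module) -h1
      rw [h2]
      exact sub_mem (add_mem (ihm _) (Submodule.smul_mem _ _ (hD _ _ (hA _ _ hy))))
        (Submodule.smul_mem _ _ (hD _ _ (hA _ _ hy)))
  | succ k ih =>
    refine words_succ_le (W := (words C K (k + 1)).comap (B m)) (fun n y hy => ?_) hx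
    rw [Submodule.mem_comap]
    clear hx
    have hDA (i j : ℤ) : D i (A j y) ∈ words C K (k + 1) :=
      h.D_mem_words hD _ _ (h.A_mem_words hA _ _ hy)
    induction m using int_induction_of_neg generalizing n with
    | neg m hm => simp [h.B_neg m hm]
    | step m ihm =>
      have h1 := h.BC m (n + 1) y
      have h2 : B m (C n y) = B (m - 1) (C (n + 1) y) + (q - q⁻¹) • D m (A n y)
          - (q - q⁻¹) • D n (A m y) + C (n + 1) (B (m - 1) y) - C n (B m y) := by
        rw [add_sub_cancel_right] at h1
        linear_combination (norm := module) -h1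
      rw [h2]
      exact sub_mem (add_mem (sub_mem (add_mem (ihm _) (Submodule.smul_mem _ _ (hDA _ _)))
        (Submodule.smul_mem _ _ (hDA _ _))) (C_mem_words (ih _ hy) _)) (C_mem_words (ih _ hy) _)

/-- Each `C_n` scales the `A_0`-eigenvalue by `q⁻¹`, so when `a ≠ 0` and `q` is not a root of unity
this eigenvalue records word length. -/
theorem RTTOperators.A_zero_apply_of_mem_words {a : ℂ} (hK : ∀ x ∈ K, A 0 x = a • x) (k : ℕ) {x : V}
    (hx : x ∈ words C K k) : A 0 x = (q⁻¹ ^ k * a) • x := by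
  induction k generalizing x with
  | zero => simpa using hK x hx
  | succ k ih =>
    refine words_succ_le (W := LinearMap.eqLocus (A 0) ((q⁻¹ ^ (k + 1) * a) • LinearMap.id))
      (fun n y hy => ?_) hx
    change A 0 (C n y) = (q⁻¹ ^ (k + 1) * a) • C n y
    rw [h.A_zero_C, ih hy, map_smul, smul_smul, pow_succ']
    ring_nf

theorem RTTOperators.D_zero_apply_of_mem_words {a : ℂ} (hK : ∀ x ∈ K, D 0 x = a • x) (k : ℕ) {x : V}
    (hx : x ∈ words C K k) : D 0 x = (q⁻¹ ^ k * a) • x := by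
  induction k generalizing x with
  | zero => simpa using hK x hx
  | succ k ih =>
    refine words_succ_le (W := LinearMap.eqLocus (D 0) ((q⁻¹ ^ (k + 1) * a) • LinearMap.id))
      (fun n y hy => ?_) hx
    change D 0 (C n y) = (q⁻¹ ^ (k + 1) * a) • C n y
    rw [h.D_zero_C, ih hy, map_smul, smul_smul, pow_succ']
    ring_nf

end words

end Operators

/-! ### The relations of the `q`-Yangian -/

theorem rttLeft_apply (q : ℂ) (X Y : Fin 2 → Fin 2 → ℤ → Free) (m n : ℤ) (a b : Fin 2 × Fin 2) :
    rttLeft q X Y m n a b = ∑ c, Rz q a c • prod1213 X Y (m - 1) n c b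
      + ∑ c, Rw q a c • prod1213 X Y m (n - 1) c b := by
  simp [rttLeft, scal, Matrix.add_apply, Matrix.mul_apply, Algebra.smul_def]

theorem rttRight_apply (q : ℂ) (X Y : Fin 2 → Fin 2 → ℤ → Free) (m n : ℤ) (a b : Fin 2 × Fin 2) :
    rttRight q X Y m n a b = ∑ c, Rz q c b • prod1312 Y X (m - 1) n a c
      + ∑ c, Rw q c b • prod1312 Y X m (n - 1) a c := by
  simp only [rttRight, scal, Matrix.add_apply, Matrix.mul_apply, Algebra.smul_def,
    Matrix.map_apply, Algebra.commutes]

theorem prod1213_apply (X Y : Fin 2 → Fin 2 → ℤ → Free) (m n : ℤ) (i j k l : Fin 2) :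
    prod1213 X Y m n (i, k) (j, l) =
      (sgn ((par k + par l) * par j) * sgn ((par i + par j) * (par k + par l))) •
        (X i j m * Y k l n) := by
  simp only [prod1213, tens, superE, Matrix.sum_apply, Matrix.map_apply, Matrix.single,
    Matrix.of_apply, Prod.mk.injEq]
  rw [Fintype.sum_eq_single i, Fintype.sum_eq_single j, Fintype.sum_eq_single k,
    Fintype.sum_eq_single l]
  · simp [smul_smul]
  all_goals intro a ha; simp [ha]

theorem prod1312_apply (X Y : Fin 2 → Fin 2 → ℤ → Free) (m n : ℤ) (i j k l : Fin 2) :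
    prod1312 Y X m n (i, k) (j, l) = sgn ((par k + par l) * par j) • (Y k l n * X i j m) := by
  simp only [prod1312, tens, superE, Matrix.sum_apply, Matrix.map_apply, Matrix.single,
    Matrix.of_apply, Prod.mk.injEq]
  rw [Fintype.sum_eq_single i, Fintype.sum_eq_single j, Fintype.sum_eq_single k,
    Fintype.sum_eq_single l]
  · simp
  all_goals intro a ha; simp [ha]

/-- The coefficient of `z^n` in `s_ij(z)`, an element of the `q`-Yangian. -/
def sCoeff (q : ℂ) (i j : Fin 2) (n : ℤ) : Yq q :=
  if 0 ≤ n then Yq.s q i j n.toNat else 0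

theorem coe_sCoeff (q : ℂ) (i j : Fin 2) (n : ℤ) :
    (sCoeff q i j n : Uq q) = mk q (coeffS i j n) := by
  unfold sCoeff coeffS
  split_ifs <;> simp [Yq.s, gen]

theorem sCoeff_natCast (q : ℂ) (i j : Fin 2) (n : ℕ) : sCoeff q i j n = Yq.s q i j n := by
  simp [sCoeff]

theorem sCoeff_of_neg (q : ℂ) (i j : Fin 2) {n : ℤ} (hn : n < 0) : sCoeff q i j n = 0 := by
  simp [sCoeff, hn]

theorem sCoeff_one_zero_zero (q : ℂ) : sCoeff q 1 0 0 = 0 := by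
  apply Subtype.ext
  have h := RingQuot.mkAlgHom_rel ℂ (Rel.s_zero (q := q) 0 1 (by decide))
  rw [map_zero] at h
  rw [coe_sCoeff]
  exact h

theorem mk_rttLeft_eq (q : ℂ) (m n : ℤ) (a b : Fin 2 × Fin 2) :
    mk q (rttLeft q coeffS coeffS m n a b) = mk q (rttRight q coeffS coeffS m n a b) :=
  RingQuot.mkAlgHom_rel ℂ (Rel.rss m n a b)

section Module

variable (q : ℂ) (V : Type*) [AddCommGroup V] [Module ℂ V] [Module (Yq q) V]
  [IsScalarTower ℂ (Yq q) V]

/-- The operator by which the coefficient of `z^n` in `s_ij(z)` acts on a module. -/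
def sOp (i j : Fin 2) (n : ℤ) : Module.End ℂ V := Algebra.lsmul ℂ ℂ V (sCoeff q i j n)

variable {V}

theorem sOp_apply (i j : Fin 2) (n : ℤ) (x : V) : sOp q V i j n x = sCoeff q i j n • x := rfl

theorem sOp_natCast (i j : Fin 2) (n : ℕ) (x : V) : sOp q V i j n x = Yq.s q i j n • x := by
  rw [sOp_apply, sCoeff_natCast]

variable (V)

set_option linter.unusedSimpArgs false in
set_option maxHeartbeats 1000000 in
-- Each of the nine quadratic relations is a single entry of the RTT matrix identity; the Koszul
-- signs come from `superE` and `prod1213`. Equalities in `Yq` are checked in `Uq`, where the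
-- relations are imposed.
theorem rttOperators_sOp :
    RTTOperators q (sOp q V 0 0) (sOp q V 0 1) (sOp q V 1 0) (sOp q V 1 1) := by
  have key (m n : ℤ) (a b : Fin 2 × Fin 2) := mk_rttLeft_eq q m n a b
  have h2 : (1 : ZMod 2) + 1 = 0 := rfl
  simp only [rttLeft_apply, rttRight_apply, map_add, map_sum, map_smul] at key
  have e (n : ℤ) (hn : n < 0) (i j : Fin 2) : sOp q V i j n = 0 := by
    simp [sOp, sCoeff_of_neg q i j hn]
  have act {u w : Yq q} (huw : (u : Uq q) = w) (x : V) : u • x = w • x := by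
    rw [Subtype.ext huw]
  constructor
  · exact fun n hn => e n hn _ _
  · exact fun n hn => e n hn _ _
  · exact fun n hn => e n hn _ _
  · exact fun n hn => e n hn _ _
  · simp [sOp, sCoeff_one_zero_zero]
  · intro m n x
    simp only [sOp_apply, ← mul_smul, ← smul_assoc, ← sub_smul, ← add_smul, ← neg_smul]
    refine act ?_ x
    have h := key m n (0, 0) (0, 0)
    simp [Fintype.sum_prod_type, Fin.sum_univ_two, Rz, Rw, prod1213_apply, prod1312_apply,
      superE, Matrix.add_apply, Matrix.single, qi, sgn, par, h2, ← coe_sCoeff] at h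
    push_cast
    linear_combination (norm := module) h
  · intro m n x
    simp only [sOp_apply, ← mul_smul, ← smul_assoc, ← sub_smul, ← add_smul, ← neg_smul]
    refine act ?_ x
    have h := key m n (1, 1) (1, 1)
    simp [Fintype.sum_prod_type, Fin.sum_univ_two, Rz, Rw, prod1213_apply, prod1312_apply,
      superE, Matrix.add_apply, Matrix.single, qi, sgn, par, h2, ← coe_sCoeff] at h
    push_cast
    linear_combination (norm := module) h
  · intro m n x
    simp only [sOp_apply, ← mul_smul, ← smul_assoc, ← sub_smul, ← add_smul, ← neg_smul]
    refine act ?_ x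
    have h := key m n (0, 1) (0, 1)
    simp [Fintype.sum_prod_type, Fin.sum_univ_two, Rz, Rw, prod1213_apply, prod1312_apply,
      superE, Matrix.add_apply, Matrix.single, qi, sgn, par, h2, ← coe_sCoeff] at h
    push_cast
    linear_combination (norm := module) h
  · intro m n x
    simp only [sOp_apply, ← mul_smul, ← smul_assoc, ← sub_smul, ← add_smul, ← neg_smul]
    refine act ?_ x
    have h := key m n (0, 0) (0, 1)
    simp [Fintype.sum_prod_type, Fin.sum_univ_two, Rz, Rw, prod1213_apply, prod1312_apply,
      superE, Matrix.add_apply, Matrix.single, qi, sgn, par, h2, ← coe_sCoeff] at h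
    push_cast
    linear_combination (norm := module) h
  · intro m n x
    simp only [sOp_apply, ← mul_smul, ← smul_assoc, ← sub_smul, ← add_smul, ← neg_smul]
    refine act ?_ x
    have h := key m n (0, 1) (1, 1)
    simp [Fintype.sum_prod_type, Fin.sum_univ_two, Rz, Rw, prod1213_apply, prod1312_apply,
      superE, Matrix.add_apply, Matrix.single, qi, sgn, par, h2, ← coe_sCoeff] at h
    push_cast
    linear_combination (norm := module) h
  · intro m n x
    simp only [sOp_apply, ← mul_smul, ← smul_assoc, ← sub_smul, ← add_smul, ← neg_smul]
    refine act ?_ x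
    have h := key m n (0, 1) (0, 0)
    simp [Fintype.sum_prod_type, Fin.sum_univ_two, Rz, Rw, prod1213_apply, prod1312_apply,
      superE, Matrix.add_apply, Matrix.single, qi, sgn, par, h2, ← coe_sCoeff] at h
    push_cast
    linear_combination (norm := module) h
  · intro m n x
    simp only [sOp_apply, ← mul_smul, ← smul_assoc, ← sub_smul, ← add_smul, ← neg_smul]
    refine act ?_ x
    have h := key m n (1, 1) (0, 1)
    simp [Fintype.sum_prod_type, Fin.sum_univ_two, Rz, Rw, prod1213_apply, prod1312_apply,
      superE, Matrix.add_apply, Matrix.single, qi, sgn, par, h2, ← coe_sCoeff] at h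
    push_cast
    linear_combination (norm := module) h
  · intro m n x
    simp only [sOp_apply, ← mul_smul, ← smul_assoc, ← sub_smul, ← add_smul, ← neg_smul]
    refine act ?_ x
    have h := key m n (0, 1) (1, 0)
    simp [Fintype.sum_prod_type, Fin.sum_univ_two, Rz, Rw, prod1213_apply, prod1312_apply,
      superE, Matrix.add_apply, Matrix.single, qi, sgn, par, h2, ← coe_sCoeff] at h
    push_cast
    linear_combination (norm := module) h
  · intro m n x
    simp only [sOp_apply, ← mul_smul, ← smul_assoc, ← sub_smul, ← add_smul, ← neg_smul]
    refine act ?_ x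
    have h := key m n (1, 1) (0, 0)
    simp [Fintype.sum_prod_type, Fin.sum_univ_two, Rz, Rw, prod1213_apply, prod1312_apply,
      superE, Matrix.add_apply, Matrix.single, qi, sgn, par, h2, ← coe_sCoeff] at h
    push_cast
    linear_combination (norm := module) h

end Module

/-! ### Submodules generated by singular subspaces -/

/-- A minimal nonzero invariant subspace `N` of `M` lies in one eigenspace of each `T i`, since `N ⊓
eigenspace` is again invariant. Commutation is required only on `M`, because `A` and `D` commute
only on vectors killed by `B`. -/
theorem exists_common_eigenvector {V ι : Type*} [AddCommGroup V] [Module ℂ V]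
    [FiniteDimensional ℂ V] (T : ι → Module.End ℂ V) {M : Submodule ℂ V} (hM : M ≠ ⊥)
    (hT : ∀ i, ∀ x ∈ M, T i x ∈ M) (hc : ∀ i j, ∀ x ∈ M, T i (T j x) = T j (T i x)) :
    ∃ x ∈ M, x ≠ 0 ∧ ∀ i, ∃ c : ℂ, T i x = c • x := by
  obtain ⟨N, ⟨hNM, hN, hNT⟩, hmin⟩ := (wellFounded_lt (α := Submodule ℂ V)).has_min
    {N | N ≤ M ∧ N ≠ ⊥ ∧ ∀ i, ∀ x ∈ N, T i x ∈ N} ⟨M, le_rfl, hM, hT⟩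
  obtain ⟨x, hxN, hx⟩ := Submodule.exists_mem_ne_zero_of_ne_bot hN
  refine ⟨x, hNM hxN, hx, fun i => ?_⟩
  have : Nontrivial N := Submodule.nontrivial_iff_ne_bot.2 hN
  obtain ⟨c, hcN⟩ := Module.End.exists_eigenvalue ((T i).restrict (hNT i))
  obtain ⟨y, hy⟩ := hcN.exists_hasEigenvector
  have hy' : T i y = c • (y : V) := congrArg Subtype.val hy.apply_eq_smul
  have hle : N ≤ Module.End.eigenspace (T i) c := by
    by_contra hlt
    refine hmin (N ⊓ Module.End.eigenspace (T i) c) ⟨inf_le_left.trans hNM, ?_, ?_⟩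
      (inf_lt_left.2 hlt)
    · rw [Submodule.ne_bot_iff]
      exact ⟨y, ⟨y.2, Module.End.mem_eigenspace_iff.2 hy'⟩, by simpa using hy.2⟩
    · rintro j z ⟨hz, hzc⟩
      refine ⟨hNT j z hz, Module.End.mem_eigenspace_iff.2 ?_⟩
      rw [hc i j z (hNM hz), Module.End.mem_eigenspace_iff.1 hzc, map_smul]
  exact ⟨c, Module.End.mem_eigenspace_iff.1 (hle hxN)⟩

theorem decompose_apply_of_shift {V : Type*} [AddCommGroup V] [Module ℂ V]
    (𝒱 : ZMod 2 → Submodule ℂ V) [DirectSum.Decomposition 𝒱] (T : Module.End ℂ V) (d : ZMod 2)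
    (hT : ∀ k, ∀ x ∈ 𝒱 k, T x ∈ 𝒱 (d + k)) (x : V) (k : ZMod 2) :
    (DirectSum.decompose 𝒱 (T x) (d + k) : V) = T (DirectSum.decompose 𝒱 x k) := by
  induction x using DirectSum.Decomposition.inductionOn 𝒱 with
  | zero => simp
  | @homogeneous i m =>
    by_cases hik : i = k
    · subst hik
      rw [DirectSum.decompose_of_mem_same 𝒱 (hT i m m.2), DirectSum.decompose_of_mem_same 𝒱 m.2]
    · rw [DirectSum.decompose_of_mem_ne 𝒱 (hT i m m.2) (by simpa using hik),
        DirectSum.decompose_of_mem_ne 𝒱 m.2 hik, map_zero]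
  | add x y hx hy => simp [DirectSum.decompose_add, hx, hy]

theorem Yq.s_mem_component (q : ℂ) (i j : Fin 2) (n : ℕ) :
    Yq.s q i j n ∈ Yq.component q (par i + par j) :=
  Submodule.subset_span ⟨[.s i j n], by simp [Gen.parity], by simp [Yq.s]⟩

section Module

variable {q : ℂ} {V : Type*} [AddCommGroup V] [Module ℂ V] [Module (Yq q) V]
  [IsScalarTower ℂ (Yq q) V]

theorem smul_mem_of_generators {W : Submodule ℂ V}
    (hs : ∀ i j n, ∀ x ∈ W, Yq.s q i j n • x ∈ W)
    (hinv : ∀ i, ∀ y : Yq q, y * Yq.s q i i 0 = 1 → ∀ x ∈ W, y • x ∈ W)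
    (y : Yq q) {x : V} (hx : x ∈ W) : y • x ∈ W := by
  obtain ⟨y, hy⟩ := y
  unfold Yq at hy
  induction hy using Algebra.adjoin_induction generalizing x with
  | mem y hy =>
    rcases hy with ⟨i, j, n, rfl⟩ | ⟨i, rfl⟩
    · exact hs i j n x hx
    · exact hinv i _ (Subtype.ext (gen_t_mul_gen_s q i)) x hx
  | algebraMap r =>
    change (algebraMap ℂ (Yq q) r) • x ∈ W
    rw [algebraMap_smul]
    exact W.smul_mem r hx
  | add a b ha hb iha ihb =>
    change ((⟨a, ha⟩ : Yq q) + ⟨b, hb⟩) • x ∈ W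
    rw [add_smul]
    exact W.add_mem (iha hx) (ihb hx)
  | mul a b ha hb iha ihb =>
    change ((⟨a, ha⟩ : Yq q) * ⟨b, hb⟩) • x ∈ W
    rw [mul_smul]
    exact iha (ihb hx)

variable (q) in
/-- A subspace of a homogeneous component that is stable under the coefficients of `s_11(z)` and
`s_22(z)`, killed by those of `s_12(z)`, and on which `s_11^(0)` and `s_22^(0)` are scalars. -/
structure IsSingularSubspace (𝒱 : ZMod 2 → Submodule ℂ V) (K : Submodule ℂ V) (k : ZMod 2)
    (a d : ℂ) : Prop where
  le_component : K ≤ 𝒱 k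
  A_mem : ∀ n, ∀ x ∈ K, sOp q V 0 0 n x ∈ K
  D_mem : ∀ n, ∀ x ∈ K, sOp q V 1 1 n x ∈ K
  B_eq_zero : ∀ n, ∀ x ∈ K, sOp q V 0 1 n x = 0
  A_zero : ∀ x ∈ K, sOp q V 0 0 0 x = a • x
  D_zero : ∀ x ∈ K, sOp q V 1 1 0 x = d • x

variable {𝒱 : ZMod 2 → Submodule ℂ V} {K : Submodule ℂ V} {k : ZMod 2} {a d : ℂ}

theorem sOp_mem_component [SetLike.GradedSMul (Yq.component q) 𝒱] (i j : Fin 2) (n : ℤ)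
    (k : ZMod 2) (x : V) (hx : x ∈ 𝒱 k) : sOp q V i j n x ∈ 𝒱 (par i + par j + k) := by
  rcases lt_or_ge n 0 with hn | hn
  · simp [sOp_apply, sCoeff_of_neg q i j hn]
  · lift n to ℕ using hn
    rw [sOp_natCast]
    exact SetLike.GradedSMul.smul_mem (Yq.s_mem_component q i j n) hx

theorem words_le_component [SetLike.GradedSMul (Yq.component q) 𝒱] (hK : K ≤ 𝒱 k) (n : ℕ) :
    words (sOp q V 1 0) K n ≤ 𝒱 (n + k) := by
  induction n with
  | zero => simpa [words] using hK
  | succ n ih =>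
    refine words_succ_le fun m x hx => ?_
    have := sOp_mem_component (q := q) 1 0 m _ x (ih hx)
    convert this using 2
    push_cast
    simp [par]
    ring

theorem IsSingularSubspace.exists_submodule (hK : IsSingularSubspace q 𝒱 K k a d) :
    ∃ W : Submodule (Yq q) V, ∀ x, x ∈ W ↔ x ∈ ⨆ n, words (sOp q V 1 0) K n := by
  have h := rttOperators_sOp q V
  have hle (n : ℕ) : words (sOp q V 1 0) K n ≤ ⨆ n, words (sOp q V 1 0) K n := le_iSup _ n
  have stable (i j : Fin 2) (n : ℤ) (x : V) (hx : x ∈ ⨆ n, words (sOp q V 1 0) K n) :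
      sOp q V i j n x ∈ ⨆ n, words (sOp q V 1 0) K n := by
    induction hx using Submodule.iSup_induction' with
    | zero => simp
    | add x y _ _ hx hy => rw [map_add]; exact add_mem hx hy
    | mem r x hx =>
      fin_cases i <;> fin_cases j
      · exact hle r (h.A_mem_words hK.A_mem r n hx)
      · cases r with
        | zero =>
          have := hK.B_eq_zero n x hx
          simp [this]
        | succ r => exact hle r (h.B_mem_words hK.A_mem hK.D_mem hK.B_eq_zero r n hx)
      · exact hle (r + 1) (C_mem_words hx n)
      · exact hle r (h.D_mem_words hK.D_mem r n hx)
  refine ⟨{ (⨆ n, words (sOp q V 1 0) K n) with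
    smul_mem' := fun y x hx => smul_mem_of_generators (fun i j n x hx => ?_) ?_ y hx },
    fun x => Iff.rfl⟩
  · rw [← sOp_natCast]
    exact stable i j n x hx
  · intro i y hy x hx
    induction hx using Submodule.iSup_induction' with
    | zero => simp
    | add x z _ _ hx hz => rw [smul_add]; exact add_mem hx hz
    | mem r x hx =>
      have hc : ∃ c : ℂ, Yq.s q i i 0 • x = c • x := by
        rw [← sOp_natCast]
        fin_cases i
        · exact ⟨_, h.A_zero_apply_of_mem_words hK.A_zero r hx⟩
        · exact ⟨_, h.D_zero_apply_of_mem_words hK.D_zero r hx⟩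
      obtain ⟨c, hc⟩ := hc
      -- The inverse of `s_ii^(0)` acts on words of fixed length by `c⁻¹`; if `c = 0`, this identity
      -- forces `x = 0`.
      have hx' : c • y • x = x := by
        rw [smul_comm, ← hc, ← mul_smul, hy, one_smul]
      rcases eq_or_ne c 0 with rfl | hc0
      · rw [← hx']
        simp
      · rw [← inv_smul_smul₀ hc0 (y • x), hx']
        exact hle r (Submodule.smul_mem _ _ hx)

/-- The words span a submodule containing `K`. It is graded because words of length `r` have parity
`r + k`, so simplicity applies. -/
theorem IsSingularSubspace.iSup_words_eq_top [DirectSum.Decomposition 𝒱]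
    [SetLike.GradedSMul (Yq.component q) 𝒱] (hV : IsSimpleSuper q 𝒱)
    (hK : IsSingularSubspace q 𝒱 K k a d) (hne : K ≠ ⊥) :
    ⨆ n, words (sOp q V 1 0) K n = ⊤ := by
  obtain ⟨W, hW⟩ := hK.exists_submodule
  have hhom : W.IsHomogeneous 𝒱 := by
    intro i x hx
    rw [hW] at hx ⊢
    induction hx using Submodule.iSup_induction' with
    | zero => simp
    | add x z _ _ hx hz =>
      rw [DirectSum.decompose_add, DirectSum.add_apply, Submodule.coe_add]
      exact add_mem hx hz
    | mem r x hx =>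
      have hxr := words_le_component hK.le_component r hx
      rcases eq_or_ne ((r : ZMod 2) + k) i with rfl | hi
      · rw [DirectSum.decompose_of_mem_same 𝒱 hxr]
        exact le_iSup (words (sOp q V 1 0) K) r hx
      · rw [DirectSum.decompose_of_mem_ne 𝒱 hxr hi]
        exact zero_mem _
  rcases hV.2 W hhom with h | h
  · obtain ⟨x, hxK, hx⟩ := Submodule.exists_mem_ne_zero_of_ne_bot hne
    have : x ∈ W := (hW x).2 (le_iSup (words (sOp q V 1 0) K) 0 hxK)
    rw [h, Submodule.mem_bot] at this
    exact absurd this hx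
  · rw [eq_top_iff]
    intro x _
    rw [← hW, h]
    trivial

theorem IsHighestLWeightVector.exists_isSingularSubspace {v : V} (hk : v ∈ 𝒱 k)
    (hv : IsHighestLWeightVector q 𝒱 v) :
    ∃ a d : ℂ, sOp q V 0 0 0 v = a • v ∧ IsSingularSubspace q 𝒱 (ℂ ∙ v) k a d := by
  have heig (i : Fin 2) (n : ℤ) : ∃ c : ℂ, sOp q V i i n v = c • v := by
    rcases lt_or_ge n 0 with hn | hn
    · exact ⟨0, by simp [sOp_apply, sCoeff_of_neg q i i hn]⟩
    · lift n to ℕ using hn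
      rw [sOp_natCast]
      exact hv.eigenvector i n
  obtain ⟨a, ha⟩ := heig 0 0
  obtain ⟨d, hd⟩ := heig 1 0
  have hmem (i : Fin 2) (n : ℤ) (x : V) (hx : x ∈ ℂ ∙ v) : sOp q V i i n x ∈ ℂ ∙ v := by
    obtain ⟨c, rfl⟩ := Submodule.mem_span_singleton.1 hx
    obtain ⟨e, he⟩ := heig i n
    rw [map_smul, he]
    exact Submodule.smul_mem _ _ (Submodule.smul_mem _ _ (Submodule.mem_span_singleton_self v))
  refine ⟨a, d, ha, ?_, hmem 0, hmem 1, fun n x hx => ?_, fun x hx => ?_, fun x hx => ?_⟩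
  · exact (Submodule.span_singleton_le_iff_mem _ _).2 hk
  all_goals obtain ⟨c, rfl⟩ := Submodule.mem_span_singleton.1 hx
  · have : sOp q V 0 1 n v = 0 := by
      rcases lt_or_ge n 0 with hn | hn
      · simp [sOp_apply, sCoeff_of_neg q _ _ hn]
      · lift n to ℕ using hn
        rw [sOp_natCast]
        exact hv.annihilated 0 1 n (by decide)
    rw [map_smul, this, smul_zero]
  · rw [map_smul, ha, smul_comm]
  · rw [map_smul, hd, smul_comm]

/-! ### Finite-dimensional simple modules are of highest `ℓ`-weight -/

/-- `B_n` multiplies `A_0`-eigenvalues by `q`. The numbers `a, q a, q² a, …` are distinct and only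
finitely many are eigenvalues, so an eigenvector for the last one before the first gap is killed by
every `B_n`. -/
theorem exists_ne_zero_B_eq_zero [FiniteDimensional ℂ V] [Nontrivial V] (hq0 : q ≠ 0)
    (hq : ∀ n : ℕ, 0 < n → q ^ n ≠ 1) : ∃ x : V, x ≠ 0 ∧ ∀ n, sOp q V 0 1 n x = 0 := by
  have h := rttOperators_sOp q V
  obtain ⟨a, ha⟩ := Module.End.exists_eigenvalue (sOp q V 0 0 0)
  have ha0 : a ≠ 0 := by
    rintro rfl
    obtain ⟨y, hy⟩ := ha.exists_hasEigenvector
    apply hy.2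
    have h1 := hy.apply_eq_smul
    rw [zero_smul, show (0 : ℤ) = ((0 : ℕ) : ℤ) from rfl, sOp_natCast] at h1
    have hu : ((sUnit q 0)⁻¹ : (Uq q)ˣ).val ∈ Yq q := Algebra.subset_adjoin (Or.inr ⟨0, rfl⟩)
    have h2 : (⟨_, hu⟩ : Yq q) * Yq.s q 0 0 0 = 1 := Subtype.ext (gen_t_mul_gen_s q 0)
    rw [← one_smul (Yq q) y, ← h2, mul_smul, h1, smul_zero]
  obtain ⟨n, hn, hn'⟩ : ∃ n : ℕ, Module.End.HasEigenvalue (sOp q V 0 0 0) (q ^ n * a) ∧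
      ¬ Module.End.HasEigenvalue (sOp q V 0 0 0) (q ^ (n + 1) * a) := by
    by_contra! hcon
    have hall (n : ℕ) : Module.End.HasEigenvalue (sOp q V 0 0 0) (q ^ n * a) := by
      induction n with
      | zero => simpa using ha
      | succ n ih => exact hcon n ih
    refine Set.infinite_of_injective_forall_mem (f := fun n : ℕ => q ^ n * a) ?_ hall
      (Module.End.finite_hasEigenvalue _)
    refine (mul_left_injective₀ ha0).comp fun m n hmn => ?_
    change q ^ m = q ^ n at hmn
    have hlt {m n : ℕ} (hmn : q ^ m = q ^ n) : n ≤ m := by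
      by_contra! hlt
      refine hq (n - m) (by omega) (mul_left_cancel₀ (pow_ne_zero m hq0) ?_)
      rw [← pow_add, Nat.add_sub_cancel' hlt.le, mul_one, hmn]
    exact le_antisymm (hlt hmn.symm) (hlt hmn)
  obtain ⟨x, hx⟩ := hn.exists_hasEigenvector
  refine ⟨x, hx.2, fun m => ?_⟩
  by_contra hne
  refine hn' (Module.End.hasEigenvalue_of_hasEigenvector (x := sOp q V 0 1 m x) ⟨?_, hne⟩)
  rw [Module.End.mem_eigenspace_iff, h.A_zero_B m x hq0, hx.apply_eq_smul, map_smul, smul_smul,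
    pow_succ']
  ring_nf

theorem exists_isHighestLWeightVector [FiniteDimensional ℂ V] [Nontrivial V] (hq0 : q ≠ 0)
    (hq : ∀ n : ℕ, 0 < n → q ^ n ≠ 1) (𝒱 : ZMod 2 → Submodule ℂ V) [DirectSum.Decomposition 𝒱]
    [SetLike.GradedSMul (Yq.component q) 𝒱] : ∃ v : V, IsHighestLWeightVector q 𝒱 v := by
  have h := rttOperators_sOp q V
  obtain ⟨x, hx, hBx⟩ := exists_ne_zero_B_eq_zero (V := V) hq0 hq
  obtain ⟨k, hk⟩ : ∃ k, (DirectSum.decompose 𝒱 x k : V) ≠ 0 := by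
    by_contra! hcon
    apply hx
    apply (DirectSum.decompose 𝒱).injective
    rw [DirectSum.decompose_zero]
    ext k
    simpa using hcon k
  -- Restricting to one parity makes the common eigenvector homogeneous.
  let M : Submodule ℂ V := 𝒱 k ⊓ ⨅ n, LinearMap.ker (sOp q V 0 1 n)
  have hM {y : V} : y ∈ M ↔ y ∈ 𝒱 k ∧ ∀ n, sOp q V 0 1 n y = 0 := by simp [M]
  have hne : M ≠ ⊥ := by
    rw [Submodule.ne_bot_iff]
    refine ⟨_, hM.2 ⟨(DirectSum.decompose 𝒱 x k).2, fun n => ?_⟩, hk⟩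
    rw [← decompose_apply_of_shift 𝒱 _ _ (sOp_mem_component 0 1 n), hBx]
    simp
  have hpar (i : Fin 2) : par i + par i + k = k := by
    rw [CharTwo.add_self_eq_zero, zero_add]
  have hstable (p : Fin 2 × ℤ) (y : V) (hy : y ∈ M) : sOp q V p.1 p.1 p.2 y ∈ M := by
    obtain ⟨i, n⟩ := p
    rw [hM] at hy ⊢
    refine ⟨hpar i ▸ sOp_mem_component i i n k y hy.1, fun m => ?_⟩
    fin_cases i
    · exact h.B_A_eq_zero hy.2 n m
    · exact h.B_D_eq_zero hy.2 n m
  have hcomm (p r : Fin 2 × ℤ) (y : V) (hy : y ∈ M) : sOp q V p.1 p.1 p.2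
      (sOp q V r.1 r.1 r.2 y) = sOp q V r.1 r.1 r.2 (sOp q V p.1 p.1 p.2 y) := by
    obtain ⟨⟨i, m⟩, ⟨j, n⟩⟩ := p, r
    rw [hM] at hy
    fin_cases i <;> fin_cases j
    · exact h.A_comm hq0 m n y
    · exact h.A_D_comm hy.2 m n
    · exact (h.A_D_comm hy.2 n m).symm
    · exact h.D_comm hq0 m n y
  obtain ⟨v, hvM, hv, hvT⟩ := exists_common_eigenvector _ hne hstable hcomm
  rw [hM] at hvM
  refine ⟨v, hv, ⟨k, hvM.1⟩, fun i j n hij => ?_, fun i n => ?_⟩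
  · obtain ⟨rfl, rfl⟩ : i = 0 ∧ j = 1 := by omega
    rw [← sOp_natCast]
    exact hvM.2 n
  · rw [← sOp_natCast]
    exact hvT (i, n)

theorem isHighestLWeightModule_of_finiteDimensional [FiniteDimensional ℂ V] (hq0 : q ≠ 0)
    (hq : ∀ n : ℕ, 0 < n → q ^ n ≠ 1) (𝒱 : ZMod 2 → Submodule ℂ V) [DirectSum.Decomposition 𝒱]
    [SetLike.GradedSMul (Yq.component q) 𝒱] (hV : IsSimpleSuper q 𝒱) :
    IsHighestLWeightModule q 𝒱 := by
  have := hV.1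
  obtain ⟨v, hv⟩ := exists_isHighestLWeightVector (V := V) hq0 hq 𝒱
  refine ⟨v, hv, ?_⟩
  obtain ⟨k, hk⟩ := hv.homogeneous
  obtain ⟨a, d, -, hK⟩ := hv.exists_isSingularSubspace hk
  have htop := hK.iSup_words_eq_top hV (by simpa using hv.ne_zero)
  have hle : ⨆ n, words (sOp q V 1 0) (ℂ ∙ v) n ≤
      (Submodule.span (Yq q) {v}).restrictScalars ℂ := by
    refine iSup_le fun n => ?_
    induction n with
    | zero =>
      exact (Submodule.span_singleton_le_iff_mem _ _).2 (Submodule.mem_span_singleton_self v)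
    | succ n ih =>
      exact words_succ_le fun m x hx =>
        (Submodule.span (Yq q) {v}).smul_mem (sCoeff q 1 0 m) (ih hx)
  rw [htop, top_le_iff, Submodule.restrictScalars_eq_top_iff] at hle
  exact hle

end Module

/-! ### Finiteness of the spaces of words -/

section Initial

variable {V : Type*} [AddCommGroup V] [Module ℂ V]

/-- The subspace `C_0 W + ⋯ + C_{j-1} W`. -/
def initialSum (C : ℤ → Module.End ℂ V) (j : ℕ) (W : Submodule ℂ V) : Submodule ℂ V :=
  ⨆ i : Fin j, W.map (C (i : ℕ))

variable {C : ℤ → Module.End ℂ V} {W : Submodule ℂ V}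

theorem C_mem_initialSum {i j : ℕ} (hij : i < j) {x : V} (hx : x ∈ W) :
    C i x ∈ initialSum C j W :=
  Submodule.mem_iSup_of_mem (⟨i, hij⟩ : Fin j) (Submodule.mem_map_of_mem hx)

theorem initialSum_le {j : ℕ} {U : Submodule ℂ V} (hU : ∀ i : ℕ, i < j → ∀ x ∈ W, C i x ∈ U) :
    initialSum C j W ≤ U :=
  iSup_le fun i => Submodule.map_le_iff_le_comap.2 fun x hx => hU i i.2 x hx

theorem initialSum_mono {i j : ℕ} (hij : i ≤ j) : initialSum C i W ≤ initialSum C j W :=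
  initialSum_le fun _ hk _ hx => C_mem_initialSum (hk.trans_le hij) hx

theorem exists_eq_sum_of_mem_initialSum {N : ℕ} {v x : V} (hx : x ∈ initialSum C N (ℂ ∙ v)) :
    ∃ b : ℕ → ℂ, x = ∑ i ∈ Finset.range N, b i • C i v := by
  induction hx using Submodule.iSup_induction' with
  | zero => exact ⟨0, by simp⟩
  | add x y _ _ hx hy =>
    obtain ⟨b, rfl⟩ := hx
    obtain ⟨c, rfl⟩ := hy
    exact ⟨b + c, by simp [add_smul, Finset.sum_add_distrib]⟩
  | mem i x hx =>
    obtain ⟨y, hy, rfl⟩ := hx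
    obtain ⟨c, rfl⟩ := Submodule.mem_span_singleton.1 hy
    refine ⟨Pi.single (i : ℕ) c, ?_⟩
    rw [Finset.sum_eq_single_of_mem (i : ℕ) (Finset.mem_range.2 i.2)]
    · simp
    · intro j _ hj
      simp [hj]

variable {q : ℂ} {A B D : ℤ → Module.End ℂ V} {K : Submodule ℂ V}
  (h : RTTOperators q A B C D)
include h

theorem RTTOperators.C_C_eq (hq0 : q ≠ 0) (n j : ℤ) (x : V) :
    C n (C (j + 1) x) = q ^ 2 • C (n + 1) (C j x) - q ^ 2 • C (j + 1) (C n x) +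
      C j (C (n + 1) x) := by
  have h1 := congrArg (q • ·) (h.CC (n + 1) (j + 1) x)
  simp only [add_sub_cancel_right, smul_add, smul_sub, smul_neg, smul_smul,
    mul_inv_cancel₀ hq0, one_smul] at h1
  linear_combination (norm := module) -h1

/-- By `C_C_eq`, `C_n C_{j+1}` becomes terms starting with `C_{j+1}` or `C_j`, and `C_{n+1} C_j`, to
which induction on `j` applies: the leading index can be made at most that of the second letter. -/
theorem RTTOperators.C_C_mem_initialSum (hq0 : q ≠ 0) (k : ℕ) (n : ℤ) (j : ℕ) {x : V}
    (hx : x ∈ words C K k) : C n (C j x) ∈ initialSum C (j + 1) (words C K (k + 1)) := by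
  induction j generalizing n with
  | zero => simp [h.C_zero]
  | succ j ih =>
    push_cast
    rw [h.C_C_eq hq0]
    refine add_mem (sub_mem (Submodule.smul_mem _ _ (initialSum_mono (Nat.le_succ _) (ih _)))
      (Submodule.smul_mem _ _ ?_)) ?_
    · exact_mod_cast C_mem_initialSum (Nat.lt_succ_self (j + 1)) (C_mem_words hx n)
    · exact C_mem_initialSum (by omega) (C_mem_words hx _)

/-- With equal indices the relation reads `(1 + q²) C_{j+1}² = q² C_{j+2} C_j + C_j C_{j+2}`, so a
repeated letter can be replaced by strictly smaller leading ones. -/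
theorem RTTOperators.C_C_self_mem_initialSum (hq0 : q ≠ 0) (hq2 : 1 + q ^ 2 ≠ 0) (k j : ℕ) {x : V}
    (hx : x ∈ words C K k) : C j (C j x) ∈ initialSum C j (words C K (k + 1)) := by
  cases j with
  | zero => simp [h.C_zero]
  | succ j =>
    have h1 := h.C_C_eq hq0 (j + 1) j x
    have h2 : C (j + 1 : ℕ) (C (j + 1 : ℕ) x) = (1 + q ^ 2)⁻¹ •
        (q ^ 2 • C (j + 1 + 1) (C j x) + C j (C (j + 1 + 1) x)) := by
      rw [eq_inv_smul_iff₀ hq2]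
      push_cast
      linear_combination (norm := module) h1
    rw [h2]
    exact Submodule.smul_mem _ _ (add_mem (Submodule.smul_mem _ _
      (h.C_C_mem_initialSum hq0 k _ j hx)) (C_mem_initialSum (Nat.lt_succ_self j)
      (C_mem_words hx _)))

theorem RTTOperators.words_succ_le_initialSum (hq0 : q ≠ 0) {N : ℕ}
    (hN : words C K 1 ≤ initialSum C N K) (k : ℕ) :
    words C K (k + 1) ≤ initialSum C N (words C K k) := by
  induction k with
  | zero => exact hN
  | succ k ih =>
    refine words_succ_le fun n x hx => ?_
    have hle : initialSum C N (words C K k) ≤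
        (initialSum C N (words C K (k + 1))).comap (C n) :=
      initialSum_le fun i hi y hy =>
        initialSum_mono (Nat.succ_le_of_lt hi) (h.C_C_mem_initialSum hq0 k n i hy)
    exact hle (ih hx)

/-- Each extra letter lowers the bound on the leading index by one: a leading letter with the top
allowed index `t` meets a second letter of index at most `t`, and the two preceding lemmas rewrite
the pair with leading index below `t`. For `i = k = N` no leading letter remains. -/
theorem RTTOperators.words_succ_le_initialSum_sub (hq0 : q ≠ 0) (hq2 : 1 + q ^ 2 ≠ 0) {N : ℕ}
    (hN : words C K 1 ≤ initialSum C N K) (i k : ℕ) (hik : i ≤ k) :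
    words C K (k + 1) ≤ initialSum C (N - i) (words C K k) := by
  induction i generalizing k with
  | zero => exact h.words_succ_le_initialSum hq0 hN k
  | succ i ih =>
    refine (ih k (by omega)).trans ?_
    obtain ⟨k, rfl⟩ : ∃ k', k = k' + 1 := ⟨k - 1, by omega⟩
    have ihk := ih k (by omega)
    rw [← Nat.sub_sub]
    rcases Nat.eq_zero_or_eq_succ_pred (N - i) with h0 | h0
    · rw [h0]
    · generalize (N - i).pred = j at h0
      rw [h0] at ihk ⊢
      rw [Nat.succ_sub_one]
      refine initialSum_le fun t ht y hy => ?_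
      rcases Nat.lt_succ_iff_lt_or_eq.1 ht with ht | rfl
      · exact C_mem_initialSum ht hy
      · have hle : initialSum C (t + 1) (words C K k) ≤
            (initialSum C t (words C K (k + 1))).comap (C t) := by
          refine initialSum_le fun s hs z hz => ?_
          rcases Nat.lt_succ_iff_lt_or_eq.1 hs with hs | rfl
          · exact initialSum_mono (Nat.succ_le_of_lt hs) (h.C_C_mem_initialSum hq0 k t s hz)
          · exact h.C_C_self_mem_initialSum hq0 hq2 k s hz
        exact hle (ihk hy)

theorem RTTOperators.finiteDimensional_iSup_words (hq0 : q ≠ 0) (hq2 : 1 + q ^ 2 ≠ 0)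
    [FiniteDimensional ℂ K] {N : ℕ} (hN : words C K 1 ≤ initialSum C N K) :
    FiniteDimensional ℂ (⨆ k, words C K k : Submodule ℂ V) := by
  have hfin (k : ℕ) : FiniteDimensional ℂ (words C K k) := by
    induction k with
    | zero => assumption
    | succ k ih =>
      have : FiniteDimensional ℂ (initialSum C N (words C K k)) := by
        unfold initialSum
        infer_instance
      exact Submodule.finiteDimensional_of_le (h.words_succ_le_initialSum hq0 hN k)
  have hle : (⨆ k, words C K k) ≤ ⨆ k : Fin (N + 1), words C K (k : ℕ) := by
    refine iSup_le fun k => ?_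
    rcases Nat.lt_or_ge k (N + 1) with hk | hk
    · exact le_iSup (fun k : Fin (N + 1) => words C K (k : ℕ)) ⟨k, hk⟩
    · obtain ⟨k, rfl⟩ : ∃ k', k = k' + 1 := ⟨k - 1, by omega⟩
      have := h.words_succ_le_initialSum_sub hq0 hq2 hN N k (by omega)
      rw [Nat.sub_self] at this
      exact this.trans (initialSum_le fun i hi => absurd hi (Nat.not_lt_zero i))
  exact Submodule.finiteDimensional_of_le hle

end Initial

/-! ### Rational power series -/

section Series

open PowerSeries

/-- The series `f(z) g_{<n}(z) - g(z) f_{<n}(z)`, where the subscript denotes truncation. -/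
def truncWronskian (f g : ℂ⟦X⟧) (n : ℕ) : ℂ⟦X⟧ := f * (trunc n g : ℂ⟦X⟧) - g * (trunc n f : ℂ⟦X⟧)

theorem truncWronskian_succ (f g : ℂ⟦X⟧) (n : ℕ) :
    truncWronskian f g (n + 1) =
      truncWronskian f g n + (C (coeff n g) * f - C (coeff n f) * g) * X ^ n := by
  have h (a : ℂ) : PowerSeries.monomial n a = C a * X ^ n := by
    ext k
    simp [coeff_monomial, coeff_X_pow]
  simp only [truncWronskian, trunc_succ, Polynomial.coe_add, Polynomial.coe_monomial, h]
  ring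

theorem coeff_truncWronskian_of_lt (f g : ℂ⟦X⟧) {k n : ℕ} (hk : k < n) :
    coeff k (truncWronskian f g n) = 0 := by
  have h1 (a b : ℂ⟦X⟧) : coeff k (a * (trunc n b : ℂ⟦X⟧)) = coeff k (a * b) := by
    rw [coeff_mul, coeff_mul]
    refine Finset.sum_congr rfl fun p hp => ?_
    have := Finset.HasAntidiagonal.mem_antidiagonal.1 hp
    rw [Polynomial.coeff_coe, coeff_trunc, if_pos (by omega)]
  rw [truncWronskian, map_sub, h1, h1, mul_comm, sub_self]

/-- `z^j g_{<N-j}` is the truncation of `z^j g` below degree `N`; sum against the coefficients of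
`u`. -/
theorem sum_coeff_mul_X_pow_mul_trunc (u g : ℂ⟦X⟧) (N : ℕ) :
    ∑ i ∈ Finset.range (N + 1), C (coeff (N - i) u) * X ^ (N - i) * (trunc i g : ℂ⟦X⟧) =
      (trunc N (u * g) : ℂ⟦X⟧) := by
  rw [← Finset.sum_range_reflect]
  ext k
  rw [Polynomial.coeff_coe, coeff_trunc, map_sum]
  have h1 (j : ℕ) (hj : j ∈ Finset.range (N + 1)) :
      coeff k (C (coeff (N - (N + 1 - 1 - j)) u) * X ^ (N - (N + 1 - 1 - j)) *
        (trunc (N + 1 - 1 - j) g : ℂ⟦X⟧)) =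
      if k < N then (if j ≤ k then coeff j u * coeff (k - j) g else 0) else 0 := by
    have hj := Finset.mem_range_succ_iff.1 hj
    rw [show N - (N + 1 - 1 - j) = j by omega, mul_assoc, coeff_C_mul, coeff_X_pow_mul',
      Polynomial.coeff_coe, coeff_trunc]
    split_ifs <;> first | rfl | omega | simp
  rw [Finset.sum_congr rfl h1]
  split_ifs with hk
  · rw [coeff_mul, Finset.Nat.sum_antidiagonal_eq_sum_range_succ (fun i j => coeff i u * coeff j g)]
    rw [← Finset.sum_filter]
    refine Finset.sum_congr (Finset.ext fun j => ?_) fun _ _ => rfl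
    simp only [Finset.mem_filter, Finset.mem_range]
    omega
  · simp

theorem coeff_sum_X_pow_mul_truncWronskian (f g : ℂ⟦X⟧) (N : ℕ) (a : ℕ → ℂ) (m : ℕ) :
    coeff (m + N) (∑ i ∈ Finset.range (N + 1), C (a i) * X ^ (N - i) * truncWronskian f g i) =
      ∑ i ∈ Finset.range (N + 1), a i * coeff (m + i) (truncWronskian f g i) := by
  rw [map_sum]
  refine Finset.sum_congr rfl fun i hi => ?_
  have hi := Finset.mem_range_succ_iff.1 hi
  rw [mul_assoc, coeff_C_mul, coeff_X_pow_mul', if_pos (by omega),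
    show m + N - (N - i) = m + i by omega]

/-- The hypothesis covers degrees at least `N`; lower degrees vanish because the `i`-th Wronskian
starts in degree `i` and is shifted by `N - i`. -/
theorem sum_X_pow_mul_truncWronskian_eq_zero (f g : ℂ⟦X⟧) (N : ℕ) (a : ℕ → ℂ)
    (ha : ∀ m, ∑ i ∈ Finset.range (N + 1), a i * coeff (m + i) (truncWronskian f g i) = 0) :
    ∑ i ∈ Finset.range (N + 1), C (a i) * X ^ (N - i) * truncWronskian f g i = 0 := by
  ext k
  rcases Nat.lt_or_ge k N with hk | hk
  · rw [map_sum, map_zero]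
    refine Finset.sum_eq_zero fun i hi => ?_
    have hi := Finset.mem_range_succ_iff.1 hi
    rw [mul_assoc, coeff_C_mul, coeff_X_pow_mul']
    split_ifs
    · rw [coeff_truncWronskian_of_lt _ _ (by omega), mul_zero]
    · rw [mul_zero]
  · obtain ⟨m, rfl⟩ := Nat.exists_eq_add_of_le' hk
    rw [coeff_sum_X_pow_mul_truncWronskian, ha, map_zero]

theorem exists_rational_of_sum_eq_zero {f g : ℂ⟦X⟧} (hf : coeff 0 f ≠ 0) (hg : coeff 0 g ≠ 0)
    {N : ℕ} (hN : 0 < N) {a : ℕ → ℂ} (haN : a N ≠ 0)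
    (ha : ∀ m, ∑ i ∈ Finset.range (N + 1), a i * coeff (m + i) (truncWronskian f g i) = 0) :
    ∃ P Q : Polynomial ℂ, P.coeff 0 ≠ 0 ∧ Q.coeff 0 ≠ 0 ∧ f * (Q : ℂ⟦X⟧) = g * (P : ℂ⟦X⟧) := by
  -- The combination of Wronskians equals `f * R g - g * R f`. Only `i = N` contributes to the
  -- constant term of `R g`, giving `a N * g(0)`; this needs `N > 0`.
  let R (g : ℂ⟦X⟧) : Polynomial ℂ :=
    ∑ i ∈ Finset.range (N + 1), Polynomial.C (a i) * Polynomial.X ^ (N - i) * trunc i g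
  have hR (g : ℂ⟦X⟧) : (R g : ℂ⟦X⟧) =
      ∑ i ∈ Finset.range (N + 1), C (a i) * X ^ (N - i) * (trunc i g : ℂ⟦X⟧) := by
    simp only [R, ← Polynomial.coeToPowerSeries.ringHom_apply, map_sum, map_mul, map_pow]
    simp
  have hR0 (g : ℂ⟦X⟧) : (R g).coeff 0 = a N * coeff 0 g := by
    simp only [R, Polynomial.finsetSum_coeff]
    rw [Finset.sum_eq_single_of_mem N (by simp)]
    · simp [coeff_trunc, hN]
    · intro i hi hiN
      have hi := Finset.mem_range_succ_iff.1 hi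
      rw [mul_assoc, Polynomial.coeff_C_mul, Polynomial.coeff_X_pow_mul', if_neg (by omega),
        mul_zero]
  refine ⟨R f, R g, ?_, ?_, ?_⟩
  · rw [hR0]
    exact mul_ne_zero haN hf
  · rw [hR0]
    exact mul_ne_zero haN hg
  · rw [← sub_eq_zero, hR, hR, ← sum_X_pow_mul_truncWronskian_eq_zero f g N a ha, Finset.mul_sum,
      Finset.mul_sum, ← Finset.sum_sub_distrib]
    refine Finset.sum_congr rfl fun i _ => ?_
    rw [truncWronskian]
    ring

theorem sum_coeff_truncWronskian_eq_zero {f g u : ℂ⟦X⟧} {P Q : Polynomial ℂ}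
    (hP : u * f = P) (hQ : u * g = Q) {N : ℕ} (hPN : P.natDegree < N) (hQN : Q.natDegree < N)
    (m : ℕ) :
    ∑ i ∈ Finset.range (N + 1), coeff (N - i) u * coeff (m + i) (truncWronskian f g i) = 0 := by
  rw [← coeff_sum_X_pow_mul_truncWronskian f g N (fun i => coeff (N - i) u)]
  have h1 : ∑ i ∈ Finset.range (N + 1), C (coeff (N - i) u) * X ^ (N - i) * truncWronskian f g i =
      f * (trunc N (u * g) : ℂ⟦X⟧) - g * (trunc N (u * f) : ℂ⟦X⟧) := by
    rw [← sum_coeff_mul_X_pow_mul_trunc, ← sum_coeff_mul_X_pow_mul_trunc, Finset.mul_sum,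
      Finset.mul_sum, ← Finset.sum_sub_distrib]
    refine Finset.sum_congr rfl fun i _ => ?_
    rw [truncWronskian]
    ring
  rw [h1, hP, hQ, trunc_coe_eq_self hPN, trunc_coe_eq_self hQN, ← hP, ← hQ]
  rw [show f * (u * g) - g * (u * f) = 0 by ring, map_zero]

end Series

/-! ### Finite-dimensionality of simple highest `ℓ`-weight modules -/

/-- On `v` the `BC` relation expresses `B_m C_n v` as `B_{m-1} C_{n+1} v` plus `(q - q⁻¹)(f_n g_m -
f_m g_n) v`, the recursion of `truncWronskian_succ`. At `m = 0` both sides start from zero. -/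
theorem RTTOperators.B_C_apply {V : Type*} [AddCommGroup V] [Module ℂ V] {q : ℂ}
    {A B C D : ℤ → Module.End ℂ V} (h : RTTOperators q A B C D) {v : V} {f g : ℂ⟦X⟧}
    (hB : ∀ n, B n v = 0) (hA : ∀ n : ℕ, A n v = PowerSeries.coeff n f • v)
    (hD : ∀ n : ℕ, D n v = PowerSeries.coeff n g • v) (m n : ℕ) :
    B m (C n v) = ((q - q⁻¹) * PowerSeries.coeff (m + n) (truncWronskian f g n)) • v := by
  have hDA (i j : ℕ) :
      D i (A j v) = (PowerSeries.coeff j f * PowerSeries.coeff i g) • v := by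
    rw [hA, map_smul, hD, smul_smul]
  have step (m n : ℕ) (hm : B ((m : ℤ) - 1) (C (n + 1 : ℕ) v) =
      ((q - q⁻¹) * PowerSeries.coeff (m + n) (truncWronskian f g (n + 1))) • v) :
      B m (C n v) = ((q - q⁻¹) * PowerSeries.coeff (m + n) (truncWronskian f g n)) • v := by
    have h1 := h.BC m (n + 1) v
    simp only [add_sub_cancel_right, hB, map_zero, neg_zero, zero_add, add_zero, hDA] at h1
    rw [truncWronskian_succ, map_add, PowerSeries.coeff_mul_X_pow, map_sub,
      PowerSeries.coeff_C_mul, PowerSeries.coeff_C_mul] at hm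
    push_cast at hm
    linear_combination (norm := module) hm - h1
  induction m generalizing n with
  | zero =>
    refine step 0 n ?_
    rw [coeff_truncWronskian_of_lt f g (by omega), h.B_neg _ (by norm_num)]
    simp
  | succ m ih =>
    refine step (m + 1) n ?_
    rw [Nat.cast_succ, add_sub_cancel_right, ih, add_right_comm, add_assoc]

section Module

variable {q : ℂ} {V : Type*} [AddCommGroup V] [Module ℂ V] [Module (Yq q) V]
  [IsScalarTower ℂ (Yq q) V] {𝒱 : ZMod 2 → Submodule ℂ V}

/-- In a simple module, a combination of the vectors `s_21^(n) v` that is killed by the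
coefficients of `s_12(z)` vanishes. -/
theorem IsSingularSubspace.eq_zero_of_mem_words_one [DirectSum.Decomposition 𝒱]
    [SetLike.GradedSMul (Yq.component q) 𝒱] (hq : ∀ n : ℕ, 0 < n → q ^ n ≠ 1)
    (hV : IsSimpleSuper q 𝒱) {v : V} (hv : v ≠ 0) {k : ZMod 2} {a d : ℂ} (ha : a ≠ 0)
    (hK : IsSingularSubspace q 𝒱 (ℂ ∙ v) k a d) {x : V}
    (hx : x ∈ words (sOp q V 1 0) (ℂ ∙ v) 1) (hB : ∀ n, sOp q V 0 1 n x = 0) : x = 0 := by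
  have h := rttOperators_sOp q V
  let K : Submodule ℂ V :=
    words (sOp q V 1 0) (ℂ ∙ v) 1 ⊓ ⨅ n, LinearMap.ker (sOp q V 0 1 n)
  have hKmem {y : V} :
      y ∈ K ↔ y ∈ words (sOp q V 1 0) (ℂ ∙ v) 1 ∧ ∀ n, sOp q V 0 1 n y = 0 := by
    simp [K]
  have hKs : IsSingularSubspace q 𝒱 K ((1 : ℕ) + k) (q⁻¹ ^ 1 * a) (q⁻¹ ^ 1 * d) :=
    { le_component := inf_le_left.trans (words_le_component hK.le_component 1)
      A_mem := fun n y hy => by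
        rw [hKmem] at hy ⊢
        exact ⟨h.A_mem_words hK.A_mem 1 n hy.1, fun m => h.B_A_eq_zero hy.2 n m⟩
      D_mem := fun n y hy => by
        rw [hKmem] at hy ⊢
        exact ⟨h.D_mem_words hK.D_mem 1 n hy.1, fun m => h.B_D_eq_zero hy.2 n m⟩
      B_eq_zero := fun n y hy => (hKmem.1 hy).2 n
      A_zero := fun y hy => h.A_zero_apply_of_mem_words hK.A_zero 1 hy.1
      D_zero := fun y hy => h.D_zero_apply_of_mem_words hK.D_zero 1 hy.1 }
  by_contra hx0
  have htop := hKs.iSup_words_eq_top hV (Submodule.ne_bot_iff _ |>.2 ⟨x, hKmem.2 ⟨hx, hB⟩, hx0⟩)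
  -- Words over `K` have `A_0`-eigenvalues `q⁻¹ ^ (n + 1) * a`, never `a`, whereas `v` has
  -- eigenvalue `a`; so they cannot span `V`.
  have hle : ⨆ n, words (sOp q V 1 0) K n ≤
      ⨆ b, ⨆ _ : b ≠ a, Module.End.eigenspace (sOp q V 0 0 0) b := by
    refine iSup_le fun n y hy => ?_
    have hy' := h.A_zero_apply_of_mem_words hKs.A_zero n hy
    rw [← mul_assoc, ← pow_add] at hy'
    refine Submodule.mem_iSup_of_mem (q⁻¹ ^ (n + 1) * a) (Submodule.mem_iSup_of_mem ?_
      (Module.End.mem_eigenspace_iff.2 hy'))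
    rw [Ne, mul_eq_right₀ ha, inv_pow, inv_eq_one]
    exact hq (n + 1) n.succ_pos
  have hva : v ∈ Module.End.eigenspace (sOp q V 0 0 0) a :=
    Module.End.mem_eigenspace_iff.2 (hK.A_zero v (Submodule.mem_span_singleton_self v))
  refine hv (Submodule.disjoint_def.1 (Module.End.eigenspaces_iSupIndep (sOp q V 0 0 0) a) v hva ?_)
  exact hle (htop ▸ Submodule.mem_top)

theorem exists_rational_of_finiteDimensional (hq0 : q ≠ 0) (hq2 : q ^ 2 ≠ 1)
    [FiniteDimensional ℂ V] {v : V} (hv : v ≠ 0) {f g : ℂ⟦X⟧}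
    (hf : PowerSeries.coeff 0 f ≠ 0) (hg : PowerSeries.coeff 0 g ≠ 0)
    (hB : ∀ n, sOp q V 0 1 n v = 0)
    (hA : ∀ n : ℕ, sOp q V 0 0 n v = PowerSeries.coeff n f • v)
    (hD : ∀ n : ℕ, sOp q V 1 1 n v = PowerSeries.coeff n g • v) :
    ∃ P Q : Polynomial ℂ, P.coeff 0 ≠ 0 ∧ Q.coeff 0 ≠ 0 ∧ f * (Q : ℂ⟦X⟧) = g * (P : ℂ⟦X⟧) := by
  have hqi : q - q⁻¹ ≠ 0 := by
    intro h0
    apply hq2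
    rw [pow_two]
    nth_rewrite 2 [sub_eq_zero.1 h0]
    exact mul_inv_cancel₀ hq0
  -- The chain of spans of the first `C_i v` stabilizes. Using index `n + 1` makes the top index of
  -- the resulting relation positive, as the rationality criterion demands.
  obtain ⟨n, hn⟩ := monotone_stabilizes_iff_noetherian.2 (inferInstance : IsNoetherian ℂ V)
    ⟨fun n => initialSum (sOp q V 1 0) n (ℂ ∙ v), fun _ _ hij => initialSum_mono hij⟩
  have hmem : sOp q V 1 0 (n + 1 : ℕ) v ∈ initialSum (sOp q V 1 0) (n + 1) (ℂ ∙ v) := by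
    have h1 := (hn (n + 1) (by omega)).symm.trans (hn (n + 2) (by omega))
    change initialSum _ (n + 1) _ = initialSum _ (n + 2) _ at h1
    rw [h1]
    exact C_mem_initialSum (by omega) (Submodule.mem_span_singleton_self v)
  obtain ⟨b, hb⟩ := exists_eq_sum_of_mem_initialSum hmem
  refine exists_rational_of_sum_eq_zero hf hg (Nat.succ_pos n)
    (a := fun i => if i = n + 1 then -1 else b i) (by simp) fun m => ?_
  have key := congrArg (sOp q V 0 1 m) hb
  simp only [map_sum, map_smul, (rttOperators_sOp q V).B_C_apply hB hA hD, smul_smul] at key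
  rw [← Finset.sum_smul] at key
  have key := smul_left_injective ℂ hv key
  simp only [mul_left_comm _ (q - q⁻¹)] at key
  rw [← Finset.mul_sum] at key
  have key := mul_left_cancel₀ hqi key
  rw [Finset.sum_range_succ, if_pos rfl, key, neg_one_mul, ← sub_eq_add_neg, sub_eq_zero]
  refine Finset.sum_congr rfl fun i hi => ?_
  rw [if_neg (Finset.mem_range.1 hi).ne]

theorem IsSingularSubspace.finiteDimensional_of_rational [DirectSum.Decomposition 𝒱]
    [SetLike.GradedSMul (Yq.component q) 𝒱] (hq0 : q ≠ 0) (hq : ∀ n : ℕ, 0 < n → q ^ n ≠ 1)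
    (hV : IsSimpleSuper q 𝒱) {v : V} (hv : v ≠ 0) {k : ZMod 2} {a d : ℂ} (ha : a ≠ 0)
    (hK : IsSingularSubspace q 𝒱 (ℂ ∙ v) k a d) {f g u : ℂ⟦X⟧}
    (hA : ∀ n : ℕ, sOp q V 0 0 n v = PowerSeries.coeff n f • v)
    (hD : ∀ n : ℕ, sOp q V 1 1 n v = PowerSeries.coeff n g • v)
    {P Q : Polynomial ℂ} (hu : PowerSeries.coeff 0 u ≠ 0) (hP : u * f = P) (hQ : u * g = Q) :
    FiniteDimensional ℂ V := by
  have h := rttOperators_sOp q V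
  have hvK := Submodule.mem_span_singleton_self (R := ℂ) v
  have hB (n : ℤ) : sOp q V 0 1 n v = 0 := hK.B_eq_zero n v hvK
  obtain ⟨M, hPM, hQM⟩ : ∃ M, P.natDegree < M ∧ Q.natDegree < M :=
    ⟨max P.natDegree Q.natDegree + 1, by omega, by omega⟩
  -- For `N` beyond both degrees the truncations of `u f` and `u g` are exact, so every `B_m` kills
  -- this combination and simplicity makes it zero. Its top coefficient is `u(0) ≠ 0`, hence it
  -- expresses `C_N v` through earlier vectors.
  have hrel (N : ℕ) (hN : M ≤ N) :
      ∑ i ∈ Finset.range (N + 1), PowerSeries.coeff (N - i) u • sOp q V 1 0 i v = 0 := by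
    refine hK.eq_zero_of_mem_words_one hq hV hv ha
      (sum_mem fun i _ => Submodule.smul_mem _ _ (C_mem_words (k := 0) hvK _)) fun m => ?_
    rcases lt_or_ge m 0 with hm | hm
    · simp [h.B_neg m hm]
    · lift m to ℕ using hm
      simp only [map_sum, map_smul, h.B_C_apply hB hA hD, smul_smul, mul_left_comm _ (q - q⁻¹)]
      rw [← Finset.sum_smul, ← Finset.mul_sum,
        sum_coeff_truncWronskian_eq_zero hP hQ (by omega) (by omega), mul_zero, zero_smul]
  have hmem (n : ℕ) : sOp q V 1 0 n v ∈ initialSum (sOp q V 1 0) M (ℂ ∙ v) := by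
    induction n using Nat.strong_induction_on with
    | _ n ih =>
      rcases Nat.lt_or_ge n M with hn | hn
      · exact C_mem_initialSum hn hvK
      · have h1 := hrel n hn
        rw [Finset.sum_range_succ, Nat.sub_self, add_comm] at h1
        rw [← Submodule.smul_mem_iff _ hu, eq_neg_of_add_eq_zero_left h1]
        exact neg_mem (sum_mem fun i hi =>
          Submodule.smul_mem _ _ (ih i (Finset.mem_range.1 hi)))
  have hone : words (sOp q V 1 0) (ℂ ∙ v) 1 ≤ initialSum (sOp q V 1 0) M (ℂ ∙ v) := by
    refine words_succ_le fun n x hx => ?_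
    obtain ⟨c, rfl⟩ := Submodule.mem_span_singleton.1 hx
    rw [map_smul]
    refine Submodule.smul_mem _ _ ?_
    rcases lt_or_ge n 0 with hn | hn
    · simp [h.C_neg n hn]
    · lift n to ℕ using hn
      exact hmem n
  have hq2 : 1 + q ^ 2 ≠ 0 := by
    intro h0
    apply hq 4 (by norm_num)
    linear_combination (q ^ 2 - 1) * h0
  have hfin := h.finiteDimensional_iSup_words hq0 hq2 hone
  rw [hK.iSup_words_eq_top hV (by simpa using hv)] at hfin
  exact Module.Finite.equiv (Submodule.topEquiv (R := ℂ) (M := V))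

end Module

end QYangian

end

theorem mainTheorem10 (q : ℂ) (hq0 : q ≠ 0) (hq : ∀ n : ℕ, 0 < n → q ^ n ≠ 1) :
    (∀ (V : Type*) [AddCommGroup V] [Module ℂ V] [Module (QYangian.Yq q) V]
        [IsScalarTower ℂ (QYangian.Yq q) V]
        (𝒱 : ZMod 2 → Submodule ℂ V) [DirectSum.Decomposition 𝒱]
        [SetLike.GradedSMul (QYangian.Yq.component q) 𝒱],
        QYangian.IsSimpleSuper q 𝒱 → FiniteDimensional ℂ V →
          QYangian.IsHighestLWeightModule q 𝒱) ∧
    (∀ (S : Type*) [AddCommGroup S] [Module ℂ S] [Module (QYangian.Yq q) S]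
        [IsScalarTower ℂ (QYangian.Yq q) S]
        (𝒮 : ZMod 2 → Submodule ℂ S) [DirectSum.Decomposition 𝒮]
        [SetLike.GradedSMul (QYangian.Yq.component q) 𝒮]
        (v : S) (f : Fin 2 → (PowerSeries ℂ)ˣ),
        QYangian.IsSimpleSuper q 𝒮 →
        QYangian.IsHighestLWeightVector q 𝒮 v →
        Submodule.span (QYangian.Yq q) {v} = ⊤ →
        v ∈ 𝒮 0 →
        (∀ (i : Fin 2) (n : ℕ),
          QYangian.Yq.s q i i n • v = PowerSeries.coeff n (f i : PowerSeries ℂ) • v) →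
        (FiniteDimensional ℂ S ↔
          ∃ P Q : Polynomial ℂ, P.coeff 0 ≠ 0 ∧ Q.coeff 0 ≠ 0 ∧
            ((f 0 / f 1 : (PowerSeries ℂ)ˣ) : PowerSeries ℂ) =
              (P : PowerSeries ℂ) * (Q : PowerSeries ℂ)⁻¹)) := by
  refine ⟨fun V _ _ _ _ 𝒱 _ _ hV _ =>
    QYangian.isHighestLWeightModule_of_finiteDimensional hq0 hq 𝒱 hV, ?_⟩
  intro S _ _ _ _ 𝒮 _ _ v f hS hv _ hv0 hf
  have hunit (i : Fin 2) : PowerSeries.coeff 0 (f i : PowerSeries ℂ) ≠ 0 := by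
    rw [PowerSeries.coeff_zero_eq_constantCoeff_apply]
    exact ((f i).isUnit.map PowerSeries.constantCoeff).ne_zero
  -- The nonzero constant term makes `Q⁻¹` a genuine inverse of power series.
  have hratio {P Q : Polynomial ℂ} (hQ : Q.coeff 0 ≠ 0) :
      ((f 0 / f 1 : (PowerSeries ℂ)ˣ) : PowerSeries ℂ) =
          (P : PowerSeries ℂ) * (Q : PowerSeries ℂ)⁻¹ ↔
        (f 0 : PowerSeries ℂ) * Q = f 1 * P := by
    rw [PowerSeries.eq_mul_inv_iff_mul_eq (by simpa using hQ), div_eq_mul_inv, Units.val_mul,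
      mul_right_comm, Units.mul_inv_eq_iff_eq_mul, mul_comm (P : PowerSeries ℂ)]
  obtain ⟨a, d, ha, hK⟩ := hv.exists_isSingularSubspace hv0
  have hop (i : Fin 2) (n : ℕ) :
      QYangian.sOp q S i i n v = PowerSeries.coeff n (f i : PowerSeries ℂ) • v := by
    rw [QYangian.sOp_natCast, hf]
  constructor
  · intro _
    obtain ⟨P, Q, hP, hQ, hPQ⟩ := QYangian.exists_rational_of_finiteDimensional hq0
      (hq 2 two_pos) hv.ne_zero (hunit 0) (hunit 1)
      (fun n => hK.B_eq_zero n v (Submodule.mem_span_singleton_self v)) (hop 0) (hop 1)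
    exact ⟨P, Q, hP, hQ, (hratio hQ).2 hPQ⟩
  · rintro ⟨P, Q, -, hQ, hPQ⟩
    rw [hratio hQ] at hPQ
    have ha0 : a ≠ 0 := by
      have h1 := hop 0 0
      rw [Nat.cast_zero, ha] at h1
      rw [smul_left_injective ℂ hv.ne_zero h1]
      exact hunit 0
    -- The multiplier is `u = Q / f 1`, which turns `f 1` into `Q` and `f 0` into `P`.
    have hug : (Q : PowerSeries ℂ) * (f 1)⁻¹.val * (f 1).val = Q := by
      rw [mul_assoc, Units.inv_mul, mul_one]
    have huf : (Q : PowerSeries ℂ) * (f 1)⁻¹.val * (f 0).val = P := by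
      rw [mul_right_comm, mul_comm (Q : PowerSeries ℂ), hPQ, mul_comm, ← mul_assoc,
        Units.inv_mul, one_mul]
    refine hK.finiteDimensional_of_rational hq0 hq hS hv.ne_zero ha0 (hop 0) (hop 1) ?_ huf hug
    rw [PowerSeries.coeff_zero_eq_constantCoeff_apply]
    intro h0
    apply hQ
    have h1 := congrArg PowerSeries.constantCoeff hug
    rw [map_mul, h0, zero_mul] at h1
    simpa using h1.symm
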